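/- **Setting.** A smoothing scheme on a measurable space $\mathcal X$ assigns to each $x$ the law of a random point $\xi(x)$. A threat model is a map $\mathcal B:\mathcal X\to 2^{\mathcal X}$; its inverted ball is the smallest map $\mathcal B^{-1}$ with $\tilde x\in\mathcal B(x)\Rightarrow x\in\mathcal B^{-1}(\tilde x)$, i.e. $\mathcal B^{-1}(\tilde x)=\{x:\tilde x\in\mathcal B(x)\}$. For $p\in[0,1]$ the optimal certified bounds at $x$ are $$\mathrm c^{\downarrow}[p,\mathcal B]=\inf\ \mathbb E[h(\xi(\tilde x))],\qquad \mathrm c^{\uparrow}[p,\mathcal B]=\sup\ \mathbb E[h(\xi(\tilde x))],$$ over all $\tilde x\in\mathcal B(x)$ and all measurable $h:\mathcal X\to[0,1]$ with $\mathbb E[h(\xi(x))]=p$. **Inverted balls.** For the closed $\ell_1$ and $\ell_2$ balls $\mathcal B_r$ in $\mathbb R^d$, $\mathcal B_r^{-1}=\mathcal B_r$. For $x\in\{0,1\}^d$ let $\mathcal B_{r_a,r_d}(x)$ be the set of vectors obtained from $x$ by toggling at most $r_a$ zero bits and at most $r_d$ one bits; then $\mathcal B_{r_a,r_d}^{-1}=\mathcal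 B_{r_d,r_a}$. **Gaussian smoothing.** Let $\xi(x)=x+\varepsilon$ with $\varepsilon\sim\mathcal N(0,\sigma^2 I)$ on $\mathbb R^d$, $\sigma>0$, $r\ge0$, let $\mathcal B_r$ be the $\ell_1$ or the $\ell_2$ ball, and let $\Phi_\sigma$ be the distribution function of $\mathcal N(0,\sigma^2)$ on $\mathbb R$. If $d\ge1$ and $p\in(0,1)$, then at every point both optima are attained, with $\mathrm c^{\downarrow}[p,\mathcal B_r]=\Phi_\sigma(\Phi_\sigma^{-1}(p)-r)$ and $\mathrm c^{\uparrow}[p,\mathcal B_r]=\Phi_\sigma(\Phi_\sigma^{-1}(p)+r)$. For every $d$, every $p\in[0,1]$ and any two points at which the lower and the upper bound are taken, $\mathrm c^{\downarrow}[\mathrm c^{\uparrow}[p,\mathcal B_r^{-1}],\mathcal B_r]=p$. **Uniform smoothing.** Let $\lambda>0$, $r\ge0$, and consider the Lipschitz bounds $\ell^{\downarrow}(p)=p-\frac r{2\lambda}$ and $\ell^{\uparrow}(p)=p+\frac r{2\lambda}$ on $\mathbb R$. (a) $\ell^{\downarrow}(\ell^{\uparrow}(p))=p$ for all $p\in\mathbb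 R$. (b) For $\xi(x)=x+\varepsilon$, $\varepsilon$ uniform on $[0,2\lambda]^d$, and the $\ell_1$ ball $\mathcal B_r$: if $d\ge1$ and $p\in[0,1]$, both optima are attained at every point, with $\mathrm c^{\downarrow}[p,\mathcal B_r]=\max(0,\ell^{\downarrow}(p))$ and $\mathrm c^{\uparrow}[p,\mathcal B_r]=\min(1,\ell^{\uparrow}(p))$. For every $d$ and any two points, $\mathrm c^{\downarrow}[\mathrm c^{\uparrow}[p,\mathcal B_r^{-1}],\mathcal B_r]=p$ for all $p\in[0,1]$ with $\ell^{\uparrow}(p)\le1$. For the $\ell_2$ ball the same identity holds for all $p\in[0,1]$ with $\mathrm c^{\uparrow}[p,\mathcal B_r^{-1}]<1$. (c) Let $s$ be a random vector in $\mathbb R^d$ with arbitrary joint law and each $s_i$ uniform on $[0,2\lambda]$, and let $\xi(x)$ be smoothing with splitting noise, $$\xi(x)_i=\tfrac12\Big(\min\big(2\lambda\big\lceil\tfrac{x_i-s_i}{2\lambda}\big\rceil+s_i,\,1\big)+\max\big(2\lambda\big\lceil\tfrac{x_i-s_i}{2\lambda}-1\big\rceil+s_i,\,0\big)\Big).$$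 Then $\ell^{\downarrow}$ and $\ell^{\uparrow}$ are certified bounds for the $\ell_1$ ball: $\ell^{\downarrow}(p)\le\mathbb E[h(\xi(\tilde x))]\le\ell^{\uparrow}(p)$ whenever $\|\tilde x-x\|_1\le r$, $h:\mathbb R^d\to[0,1]$ is measurable and $\mathbb E[h(\xi(x))]=p$. **Sparse smoothing.** Let $p_0,p_1\in(0,1)$ and let $\xi(x)=x\oplus\varepsilon$ on $\{0,1\}^d$ with independent $\varepsilon_i\sim\mathrm{Bernoulli}(p_{x_i})$. Let $u=(0,\dots,0,1,\dots,1)\in\{0,1\}^{r_a+r_d}$ with $r_a$ zeros and $r_d$ ones, $\tilde u=\mathbf 1-u$, and, for $0\le q\le r_a+r_d$, $t_q=\Pr[\|\xi(u)-u\|_0=q]$, $\tilde t_q=\Pr[\|\xi(\tilde u)-u\|_0=q]$. Let $L_{r_a,r_d}(p)$ and $U_{r_a,r_d}(p)$ be the minimum and the maximum of $\sum_q h_q\tilde t_q$ over $h\in[0,1]^{r_a+r_d+1}$ with $\sum_q h_qt_q=p$. (a) $L_{r_a,r_d}(U_{r_d,r_a}(p))=p$ for all $p\in[0,1]$. (b)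 For every $d$, every $x\in\{0,1\}^d$, every $\tilde x\in\mathcal B_{r_a,r_d}(x)$ and every $h:\{0,1\}^d\to[0,1]$ with $\mathbb E[h(\xi(x))]=p$, $L_{r_a,r_d}(p)\le\mathbb E[h(\xi(\tilde x))]\le U_{r_a,r_d}(p)$. (c) If $x$ has at least $r_a$ zero bits and at least $r_d$ one bits, then for all $p\in[0,1]$ both optima at $x$ are attained and $\mathrm c^{\downarrow}[p,\mathcal B_{r_a,r_d}]=L_{r_a,r_d}(p)$, $\mathrm c^{\uparrow}[p,\mathcal B_{r_a,r_d}]=U_{r_a,r_d}(p)$. (d) $\mathrm c^{\downarrow}[\mathrm c^{\uparrow}[p,\mathcal B_{r_a,r_d}^{-1}],\mathcal B_{r_a,r_d}]=p$ for all $p\in[0,1]$, where the lower bound is taken at any $x\in\{0,1\}^d$ with at least $r_a$ zero and $r_d$ one bits and the upper bound at any $y\in\{0,1\}^d$ with at least $r_d$ zero and $r_a$ one bits. -/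

import Mathlib

open MeasureTheory ProbabilityTheory
open scoped ENNReal NNReal

noncomputable section

namespace Smoothing

/-! ### Balls and inverted balls -/

/-- The inverted ball of a threat model `B`: the smallest set-valued map `B'` such that
`x̃ ∈ B x` always implies `x ∈ B' x̃` (see `invBall_isLeast`). -/
def invBall {X : Type*} (B : X → Set X) : X → Set X :=
  fun x' => {x | x' ∈ B x}

theorem invBall_isLeast {X : Type*} (B : X → Set X) :
    IsLeast {B' : X → Set X | ∀ x, ∀ x' ∈ B x, x ∈ B' x'} (invBall B) :=
  ⟨fun _ _ h => h, fun _ hB' x' x hx => hB' x x' hx⟩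

/-- The closed `ℓ_q` ball of radius `r` in `ℝ^d`. -/
def lpBall {d : ℕ} (q : ℝ≥0∞) (r : ℝ) (x : Fin d → ℝ) : Set (Fin d → ℝ) :=
  {x' | ‖WithLp.toLp q (x' - x)‖ ≤ r}

/-- Binary vectors obtained from `x` by toggling at most `ra` zero bits and `rd` one bits. -/
def sparseBall {d : ℕ} (ra rd : ℕ) (x : Fin d → Bool) : Set (Fin d → Bool) :=
  {x' | (Finset.univ.filter fun i => x i = true ∧ x' i = false).card ≤ rd ∧
    (Finset.univ.filter fun i => x i = false ∧ x' i = true).card ≤ ra}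

/-! ### Certified bounds of a smoothing scheme

A smoothing scheme on `X` is given by the law `ξ x` of the randomized point, for every `x`. -/

/-- The values `E[h(ξ(x̃))]` that are possible for `x̃ ∈ B x` and a measurable
`h : X → [0,1]` with `E[h(ξ(x))] = p`. -/
def certValues {X : Type*} [MeasurableSpace X] (ξ : X → Measure X) (B : X → Set X)
    (x : X) (p : ℝ) : Set ℝ :=
  {v | ∃ x' ∈ B x, ∃ h : X → ℝ, Measurable h ∧ (∀ z, h z ∈ Set.Icc (0 : ℝ) 1) ∧
    ∫ z, h z ∂(ξ x) = p ∧ ∫ z, h z ∂(ξ x') = v}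

/-- Certified lower bound: the optimal value of the minimization problem. -/
def certLower {X : Type*} [MeasurableSpace X] (ξ : X → Measure X) (B : X → Set X)
    (x : X) (p : ℝ) : ℝ :=
  sInf (certValues ξ B x p)

/-- Certified upper bound: the optimal value of the maximization problem. -/
def certUpper {X : Type*} [MeasurableSpace X] (ξ : X → Measure X) (B : X → Set X)
    (x : X) (p : ℝ) : ℝ :=
  sSup (certValues ξ B x p)

/-! ### Gaussian smoothing -/

/-- The law of `x + ε`, where `ε` has independent `N(0, σ²)` coordinates. -/
def gaussianScheme {d : ℕ} (σ : ℝ≥0) (x : Fin d → ℝ) : Measure (Fin d → ℝ) :=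
  (Measure.pi fun _ : Fin d => gaussianReal 0 (σ ^ 2)).map fun ε => x + ε

/-- Distribution function of `N(0, σ²)` on `ℝ`. -/
def gaussCDF (σ : ℝ≥0) (t : ℝ) : ℝ := cdf (gaussianReal 0 (σ ^ 2)) t

/-- Quantile function of `N(0, σ²)`; the inverse of `gaussCDF σ` on `(0, 1)` if `0 < σ`. -/
def gaussQuantile (σ : ℝ≥0) (p : ℝ) : ℝ := sInf {t : ℝ | p ≤ gaussCDF σ t}

/-! ### Uniform smoothing -/

/-- The law of `x + ε`, where `ε` is uniform on `[0, 2λ]^d` (with `l` for `λ`). -/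
def uniformScheme {d : ℕ} (l : ℝ) (x : Fin d → ℝ) : Measure (Fin d → ℝ) :=
  (Measure.pi fun _ : Fin d => cond (volume : Measure ℝ) (Set.Icc 0 (2 * l))).map
    fun ε => x + ε

/-- Lower bound that subtracts `r` times the Lipschitz constant `1/(2λ)`. -/
def lipLower (l r p : ℝ) : ℝ := p - r / (2 * l)

/-- Upper bound that adds `r` times the Lipschitz constant `1/(2λ)`. -/
def lipUpper (l r p : ℝ) : ℝ := p + r / (2 * l)

/-- Splitting noise: each coordinate `x i` is replaced by the midpoint of the cell that
contains it when `[0, 1]` is cut at the points of `s i + 2λℤ`. -/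
def splitPoint {d : ℕ} (l : ℝ) (x s : Fin d → ℝ) : Fin d → ℝ := fun i =>
  (min (2 * l * (⌈(x i - s i) / (2 * l)⌉ : ℝ) + s i) 1 +
    max (2 * l * (⌈(x i - s i) / (2 * l) - 1⌉ : ℝ) + s i) 0) / 2

/-- Smoothing with splitting noise, for offsets `s` with joint law `ν`. -/
def splitScheme {d : ℕ} (l : ℝ) (ν : Measure (Fin d → ℝ)) (x : Fin d → ℝ) :
    Measure (Fin d → ℝ) :=
  ν.map fun s => splitPoint l x s

/-! ### Sparse smoothing -/

/-- The law of `x ⊕ ε` with independent `ε i ∼ Bernoulli(p0)` where `x i = 0` and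
`ε i ∼ Bernoulli(p1)` where `x i = 1`. -/
def sparseScheme {d : ℕ} (p0 p1 : unitInterval) (x : Fin d → Bool) :
    Measure (Fin d → Bool) :=
  (Measure.pi fun i : Fin d => bernoulliMeasure true false (if x i then p1 else p0)).map
    fun ε i => xor (x i) (ε i)

/-- `x` has at least `a` zero bits and at least `b` one bits. -/
def HasBits {d : ℕ} (a b : ℕ) (x : Fin d → Bool) : Prop :=
  a ≤ (Finset.univ.filter fun i => x i = false).card ∧
    b ≤ (Finset.univ.filter fun i => x i = true).card

/-- The canonical point `[0, …, 0, 1, …, 1]` with `ra` zeros and `rd` ones. -/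
def canonPoint (ra rd : ℕ) : Fin (ra + rd) → Bool :=
  Fin.append (fun _ => false) (fun _ => true)

/-- The canonical perturbed point `1 - canonPoint`. -/
def canonPoint' (ra rd : ℕ) : Fin (ra + rd) → Bool := fun i => !canonPoint ra rd i

/-- Probability that the randomized `canonPoint` is at Hamming distance `q` from
`canonPoint`. -/
def regionMass (p0 p1 : unitInterval) (ra rd : ℕ) (q : Fin (ra + rd + 1)) : ℝ :=
  (sparseScheme p0 p1 (canonPoint ra rd)).real
    {z | hammingDist (canonPoint ra rd) z = (q : ℕ)}

/-- Probability that the randomized `canonPoint'` is at Hamming distance `q` from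
`canonPoint`. -/
def regionMass' (p0 p1 : unitInterval) (ra rd : ℕ) (q : Fin (ra + rd + 1)) : ℝ :=
  (sparseScheme p0 p1 (canonPoint' ra rd)).real
    {z | hammingDist (canonPoint ra rd) z = (q : ℕ)}

/-- Feasible values of the linear program with one variable in `[0, 1]` for each of the
`ra + rd + 1` regions of constant likelihood ratio. -/
def lpValues (p0 p1 : unitInterval) (ra rd : ℕ) (p : ℝ) : Set ℝ :=
  {v | ∃ h : Fin (ra + rd + 1) → ℝ, (∀ q, h q ∈ Set.Icc (0 : ℝ) 1) ∧
    ∑ q, h q * regionMass p0 p1 ra rd q = p ∧ ∑ q, h q * regionMass' p0 p1 ra rd q = v}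

/-- Certified lower bound of sparse smoothing for `sparseBall ra rd`. -/
def sparseLower (p0 p1 : unitInterval) (ra rd : ℕ) (p : ℝ) : ℝ :=
  sInf (lpValues p0 p1 ra rd p)

/-- Certified upper bound of sparse smoothing for `sparseBall ra rd`. -/
def sparseUpper (p0 p1 : unitInterval) (ra rd : ℕ) (p : ℝ) : ℝ :=
  sSup (lpValues p0 p1 ra rd p)

end Smoothing

end

/-! Fix two points with laws `μ` and `ν`. The expectations reachable at level `p` are the powers of
randomized tests of `μ` against `ν` (`testValues`), and a certified bound optimizes them over the
ball. Replacing `h` by `1 - h` turns lower bounds into upper bounds. The principle behind the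
inversion is that the largest power at a given level and the smallest level at that power are
inverse functions, with the roles of the two laws exchanged; this exchange is what the inverted ball
accounts for. For each scheme it remains to find the worst displacement, whose testing problem must
not depend on the base point.

Gaussian noise: the likelihood ratio is monotone in the coordinate along the displacement, so
half-spaces are optimal by Neyman–Pearson (`measureReal_le_of_mem_testValues`), and only the
Euclidean length of the displacement matters. Its maximum over either ball is `r`, reached on an
axis.

Uniform noise: the two laws coincide on the overlap of their cubes, so a test gains or loses at most
the `overhang` (`isLeast_testValues_of_restrict_eq`). A union bound estimates it by the `ℓ₁` norm,
and axis shifts attain the estimate. For splitting noise, both points use the same offsets, and a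
random grid rarely separates nearby points.

Sparse noise: untouched bits can be simulated, so every pair in the ball is at most as
distinguishable as the canonical pair (`testValues_subset_of_mem_sparseBall`), which itself occurs
when there are enough bits. Its likelihood ratio depends on the Hamming distance only, so the linear
program is its testing problem (`lpValues_eq_testValues`). Exchanging `ra` and `rd` exchanges the
two laws, and `isLeast_testValues_of_isGreatest` concludes. -/

noncomputable section

namespace Smoothing

/-! ### Randomized tests between two laws. -/

section General

variable {X : Type*} [MeasurableSpace X]

/-- The values `∫ h ∂ν` that are possible for a measurable `h : X → [0,1]` with `∫ h ∂μ = p`. -/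
def testValues (μ ν : Measure X) (p : ℝ) : Set ℝ :=
  {v | ∃ h : X → ℝ, Measurable h ∧ (∀ z, h z ∈ Set.Icc (0 : ℝ) 1) ∧
    ∫ z, h z ∂μ = p ∧ ∫ z, h z ∂ν = v}

theorem mem_certValues {ξ : X → Measure X} {B : X → Set X} {x : X} {p v : ℝ} :
    v ∈ certValues ξ B x p ↔ ∃ x' ∈ B x, v ∈ testValues (ξ x) (ξ x') p := Iff.rfl

theorem integrable_of_mem_Icc (μ : Measure X) [IsFiniteMeasure μ] {h : X → ℝ}
    (hm : Measurable h) (h01 : ∀ z, h z ∈ Set.Icc (0 : ℝ) 1) : Integrable h μ :=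
  Integrable.of_mem_Icc 0 1 hm.aemeasurable (ae_of_all _ h01)

theorem integral_mem_Icc (μ : Measure X) [IsProbabilityMeasure μ] {h : X → ℝ}
    (hm : Measurable h) (h01 : ∀ z, h z ∈ Set.Icc (0 : ℝ) 1) :
    ∫ z, h z ∂μ ∈ Set.Icc (0 : ℝ) 1 := by
  refine ⟨integral_nonneg fun z => (h01 z).1, ?_⟩
  calc ∫ z, h z ∂μ ≤ ∫ _, (1 : ℝ) ∂μ :=
        integral_mono (integrable_of_mem_Icc μ hm h01) (integrable_const _) fun z => (h01 z).2
    _ = 1 := by simp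

theorem testValues_subset_Icc (μ ν : Measure X) [IsProbabilityMeasure ν] (p : ℝ) :
    testValues μ ν p ⊆ Set.Icc 0 1 := by
  rintro v ⟨h, hm, h01, -, rfl⟩
  exact integral_mem_Icc ν hm h01

theorem mem_Icc_of_mem_testValues {μ ν : Measure X} [IsProbabilityMeasure μ] {p v : ℝ}
    (hv : v ∈ testValues μ ν p) : p ∈ Set.Icc (0 : ℝ) 1 := by
  obtain ⟨h, hm, h01, rfl, -⟩ := hv
  exact integral_mem_Icc μ hm h01

theorem eq_of_mem_testValues_self {μ : Measure X} {p v : ℝ} (hv : v ∈ testValues μ μ p) :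
    v = p := by
  obtain ⟨h, -, -, rfl, rfl⟩ := hv
  rfl

theorem self_mem_testValues (μ ν : Measure X) [IsProbabilityMeasure μ] [IsProbabilityMeasure ν]
    {p : ℝ} (hp : p ∈ Set.Icc (0 : ℝ) 1) : p ∈ testValues μ ν p :=
  ⟨fun _ => p, measurable_const, fun _ => hp, by simp, by simp⟩

theorem one_sub_mem_testValues {μ ν : Measure X} [IsProbabilityMeasure μ]
    [IsProbabilityMeasure ν] {p v : ℝ} (hv : v ∈ testValues μ ν p) :
    1 - v ∈ testValues μ ν (1 - p) := by
  obtain ⟨h, hm, h01, rfl, rfl⟩ := hv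
  refine ⟨fun z => 1 - h z, measurable_const.sub hm,
    fun z => ⟨by linarith [(h01 z).2], by linarith [(h01 z).1]⟩, ?_, ?_⟩
  · rw [integral_sub (integrable_const _) (integrable_of_mem_Icc μ hm h01)]; simp
  · rw [integral_sub (integrable_const _) (integrable_of_mem_Icc ν hm h01)]; simp

theorem isGreatest_testValues_of_isLeast {μ ν : Measure X} [IsProbabilityMeasure μ]
    [IsProbabilityMeasure ν] {p a : ℝ} (h : IsLeast (testValues μ ν (1 - p)) a) :
    IsGreatest (testValues μ ν p) (1 - a) := by
  refine ⟨by simpa using one_sub_mem_testValues h.1, fun v hv => ?_⟩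
  linarith [h.2 (one_sub_mem_testValues hv)]

theorem isGreatest_certValues_of_isLeast {ξ : X → Measure X} [∀ x, IsProbabilityMeasure (ξ x)]
    {B : X → Set X} {x : X} {p a : ℝ} (h : IsLeast (certValues ξ B x (1 - p)) a) :
    IsGreatest (certValues ξ B x p) (1 - a) := by
  obtain ⟨⟨x', hx', ha⟩, hl⟩ := h
  refine ⟨mem_certValues.2 ⟨x', hx', ?_⟩, ?_⟩
  · simpa using one_sub_mem_testValues ha
  rintro v ⟨y, hy, hv⟩
  linarith [hl ⟨y, hy, one_sub_mem_testValues hv⟩]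

theorem bddBelow_certValues (ξ : X → Measure X) [∀ x, IsProbabilityMeasure (ξ x)]
    (B : X → Set X) (x : X) (p : ℝ) : BddBelow (certValues ξ B x p) := by
  refine ⟨0, ?_⟩
  rintro v ⟨x', -, hv⟩
  exact (testValues_subset_Icc _ _ _ hv).1

theorem bddAbove_certValues (ξ : X → Measure X) [∀ x, IsProbabilityMeasure (ξ x)]
    (B : X → Set X) (x : X) (p : ℝ) : BddAbove (certValues ξ B x p) := by
  refine ⟨1, ?_⟩
  rintro v ⟨x', -, hv⟩
  exact (testValues_subset_Icc _ _ _ hv).2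

theorem certValues_eq_singleton {ξ : X → Measure X} [∀ x, IsProbabilityMeasure (ξ x)]
    {B : X → Set X} {x : X} (hx : x ∈ B x) {p : ℝ} (hp : p ∈ Set.Icc (0 : ℝ) 1)
    (h : ∀ x' ∈ B x, ∀ v ∈ testValues (ξ x) (ξ x') p, v = p) : certValues ξ B x p = {p} := by
  ext v
  refine ⟨?_, ?_⟩
  · rintro ⟨x', hx', hv⟩
    exact h x' hx' v hv
  · rintro rfl
    exact ⟨x, hx, self_mem_testValues _ _ hp⟩

theorem certValues_eq_singleton_of_subsingleton [Subsingleton X] {ξ : X → Measure X}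
    [∀ x, IsProbabilityMeasure (ξ x)] {B : X → Set X} {x : X} (hx : x ∈ B x) {p : ℝ}
    (hp : p ∈ Set.Icc (0 : ℝ) 1) : certValues ξ B x p = {p} := by
  refine certValues_eq_singleton hx hp fun x' _ v hv => ?_
  obtain rfl := Subsingleton.elim x x'
  exact eq_of_mem_testValues_self hv

/-- A test of level 1 equals 1 `μ`-almost everywhere, and absolute continuity carries this over to
`ν`. This covers the endpoints of `[0, 1]`. -/
theorem eq_one_of_mem_testValues_one {μ ν : Measure X} [IsProbabilityMeasure μ]
    [IsProbabilityMeasure ν] (hνμ : ν ≪ μ) {v : ℝ} (hv : v ∈ testValues μ ν 1) : v = 1 := by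
  obtain ⟨h, hm, h01, hp, rfl⟩ := hv
  have h0 : ∫ z, (1 - h z) ∂μ = 0 := by
    rw [integral_sub (integrable_const _) (integrable_of_mem_Icc μ hm h01), hp]; simp
  rw [integral_eq_zero_iff_of_nonneg (fun z => sub_nonneg.2 (h01 z).2)
    ((integrable_const _).sub (integrable_of_mem_Icc μ hm h01))] at h0
  have h1 : h =ᵐ[ν] fun _ => 1 := by
    filter_upwards [hνμ.ae_le h0] with z hz
    have : 1 - h z = 0 := hz
    linarith
  rw [integral_congr_ae h1]; simp

theorem eq_zero_of_mem_testValues_zero {μ ν : Measure X} [IsProbabilityMeasure μ]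
    [IsProbabilityMeasure ν] (hνμ : ν ≪ μ) {v : ℝ} (hv : v ∈ testValues μ ν 0) : v = 0 := by
  have := eq_one_of_mem_testValues_one hνμ (by simpa using one_sub_mem_testValues hv)
  linarith

/-- The largest power at level `p` and the smallest level at that power are inverse. -/
theorem isLeast_testValues_of_isGreatest {μ ν : Measure X} [IsProbabilityMeasure μ]
    [IsProbabilityMeasure ν] (hνμ : ν ≪ μ) {p P : ℝ} (h : IsGreatest (testValues ν μ p) P) :
    IsLeast (testValues μ ν P) p := by
  have hp := mem_Icc_of_mem_testValues h.1
  refine ⟨?_, fun v hv => ?_⟩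
  · obtain ⟨g, hm, h01, h1, h2⟩ := h.1
    exact ⟨g, hm, h01, h2, h1⟩
  by_contra! hlt
  have hP : P < 1 := by
    refine lt_of_le_of_ne (testValues_subset_Icc _ _ _ h.1).2 ?_
    rintro rfl
    linarith [eq_one_of_mem_testValues_one hνμ hv, hp.2]
  obtain ⟨g, hm, h01, h1, h2⟩ := hv
  have hv1 : 0 < 1 - v := by linarith [hp.2]
  -- Mixing `g` with the constant test 1 at weight `c` raises its `ν`-integral from `v` to exactly
  -- `p`. Its `μ`-integral then exceeds `P`, because `P < 1`, against maximality.
  set c := (p - v) / (1 - v) with hc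
  have hc0 : 0 < c := div_pos (by linarith) hv1
  have hc1 : c ≤ 1 := (div_le_one hv1).2 (by linarith [hp.2])
  have key : ∀ (m : Measure X) [IsProbabilityMeasure m],
      ∫ z, (c + (1 - c) * g z) ∂m = c + (1 - c) * ∫ z, g z ∂m := fun m _ => by
    rw [integral_add (integrable_const _) ((integrable_of_mem_Icc m hm h01).const_mul _),
      integral_const_mul]
    simp
  have hmem : c + (1 - c) * P ∈ testValues ν μ p := by
    refine ⟨fun z => c + (1 - c) * g z, by fun_prop, fun z => ⟨?_, ?_⟩, ?_, ?_⟩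
    · have := mul_nonneg (sub_nonneg.2 hc1) (h01 z).1
      linarith
    · nlinarith [(h01 z).2]
    · rw [key, h2, hc]; field_simp; ring
    · rw [key, h1]
  nlinarith [h.2 hmem]

/-- The Neyman–Pearson lemma for a likelihood ratio `L` and a threshold `k`. -/
theorem measureReal_le_of_mem_testValues {μ ν : Measure X} [IsProbabilityMeasure μ]
    [IsProbabilityMeasure ν] {L : X → ℝ} (hL : Measurable L) (hL0 : ∀ z, 0 ≤ L z)
    (hν : ν = μ.withDensity fun z => ENNReal.ofReal (L z)) {A : Set X} (hA : MeasurableSet A)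
    {k : ℝ} (hle : ∀ z ∈ A, L z ≤ k) (hge : ∀ z ∉ A, k ≤ L z) {v : ℝ}
    (hv : v ∈ testValues μ ν (μ.real A)) : ν.real A ≤ v := by
  obtain ⟨h, hm, h01, h1, rfl⟩ := hv
  have hint : ∀ f : X → ℝ, ∫ z, f z ∂ν = ∫ z, L z * f z ∂μ := fun f => by
    rw [hν, integral_withDensity_eq_integral_toReal_smul (by fun_prop) (by simp)]
    simp [hL0]
  have hLi : Integrable L μ := by
    rw [← lintegral_ofReal_ne_top_iff_integrable hL.aestronglyMeasurable (ae_of_all _ hL0),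
      ← setLIntegral_univ, ← withDensity_apply _ MeasurableSet.univ, ← hν]
    simp
  have hi : ∀ f : X → ℝ, Measurable f → (∀ z, f z ∈ Set.Icc (0 : ℝ) 1) →
      Integrable (fun z => L z * f z) μ := fun f hf hf01 =>
    hLi.mul_bdd (c := 1) hf.aestronglyMeasurable
      (ae_of_all _ fun z => by rw [Real.norm_of_nonneg (hf01 z).1]; exact (hf01 z).2)
  have hAm : Measurable (A.indicator (fun _ => (1 : ℝ))) := measurable_const.indicator hA
  have hA01 : ∀ z, A.indicator (fun _ => (1 : ℝ)) z ∈ Set.Icc (0 : ℝ) 1 := fun z => by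
    by_cases hz : z ∈ A <;> simp [hz]
  have hAν : ν.real A = ∫ z, A.indicator (fun _ => (1 : ℝ)) z ∂ν := by
    simp [integral_indicator hA]
  have hAμ : μ.real A = ∫ z, A.indicator (fun _ => (1 : ℝ)) z ∂μ := by
    simp [integral_indicator hA]
  -- The integrand is `(L - k) * (h - 1_A)`; both factors are nonpositive on `A` and nonnegative off
  -- `A`.
  have hpos : 0 ≤ ∫ z, (L z * h z - L z * A.indicator (fun _ => (1 : ℝ)) z
      - (k * h z - k * A.indicator (fun _ => (1 : ℝ)) z)) ∂μ := by
    refine integral_nonneg fun z => ?_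
    by_cases hz : z ∈ A
    · simp only [Set.indicator_of_mem hz, Pi.zero_apply]
      nlinarith [hle z hz, (h01 z).2]
    · simp only [Set.indicator_of_notMem hz, Pi.zero_apply]
      nlinarith [hge z hz, (h01 z).1]
  have hhi := (integrable_of_mem_Icc μ hm h01).const_mul k
  have hAi := (integrable_of_mem_Icc μ hAm hA01).const_mul k
  rw [integral_sub (f := fun z => L z * h z - L z * A.indicator (fun _ => (1 : ℝ)) z)
      (g := fun z => k * h z - k * A.indicator (fun _ => (1 : ℝ)) z)
      ((hi _ hm h01).sub (hi _ hAm hA01)) (hhi.sub hAi),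
    integral_sub (hi _ hm h01) (hi _ hAm hA01), integral_sub hhi hAi, integral_const_mul,
    integral_const_mul, ← hint, ← hint, ← hAν, ← hAμ, h1] at hpos
  linarith

/-- If `μ` and `ν` agree on their common support, the optimal test is governed by the mass that
`μ` puts outside the support of `ν`. -/
theorem isLeast_testValues_of_restrict_eq {μ ν : Measure X} [IsProbabilityMeasure μ]
    [IsProbabilityMeasure ν] {S T : Set X} (hS : MeasurableSet S) (hT : MeasurableSet T)
    (hμ : μ Sᶜ = 0) (hν : ν Tᶜ = 0) (hST : μ.restrict T = ν.restrict S) {p : ℝ}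
    (hp : p ∈ Set.Icc (0 : ℝ) 1) :
    IsLeast (testValues μ ν p) (max 0 (p - μ.real Tᶜ)) := by
  set τ := μ.real Tᶜ with hτ
  have hτ0 : 0 ≤ τ := measureReal_nonneg
  have hT1 : μ.real T = 1 - τ := by rw [hτ, probReal_compl_eq_one_sub hT]; ring
  constructor
  · rcases le_or_gt p τ with hpτ | hpτ
    · rw [max_eq_left (by linarith)]
      -- The level is spent entirely where `ν` has no mass. If `τ = 0`, the quotient is 0 by
      -- convention, which is right since then `p = 0`.
      refine ⟨Tᶜ.indicator fun _ => p / τ, measurable_const.indicator hT.compl, fun z => ?_,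
        ?_, ?_⟩
      · by_cases hz : z ∈ Tᶜ
        · rw [Set.indicator_of_mem hz]
          exact ⟨div_nonneg hp.1 hτ0, div_le_one_of_le₀ hpτ hτ0⟩
        · rw [Set.indicator_of_notMem hz]; simp
      · rw [integral_indicator hT.compl, setIntegral_const, ← hτ, smul_eq_mul]
        rcases hτ0.eq_or_lt with h0 | h0
        · rw [← h0] at hpτ ⊢
          linarith [hp.1]
        · field_simp
      · rw [integral_indicator hT.compl, setIntegral_const]
        simp [measureReal_def, hν]
    · have hτ1 : 0 < 1 - τ := by linarith [hp.2]
      rw [max_eq_right (by linarith)]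
      have hTS : μ.real (S ∩ T) = 1 - τ := by
        rw [← hT1, Set.inter_comm]
        exact measureReal_congr (inter_ae_eq_left_of_ae_eq_univ (ae_eq_univ.2 hμ))
      have hTS' : ν.real (S ∩ T) = 1 - τ := by
        rw [← hTS, measureReal_def, measureReal_def, Set.inter_comm,
          ← Measure.restrict_apply hT, ← hST, Measure.restrict_apply hT, Set.inter_self,
          inter_ae_eq_left_of_ae_eq_univ (ae_eq_univ.2 hμ) |> measure_congr]
      have key : ∀ (m : Measure X) [IsProbabilityMeasure m],
          ∫ z, (Tᶜ.indicator (fun _ => (1 : ℝ)) z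
            + (S ∩ T).indicator (fun _ => (p - τ) / (1 - τ)) z) ∂m
            = m.real Tᶜ + m.real (S ∩ T) * ((p - τ) / (1 - τ)) := fun m _ => by
        rw [integral_add ((integrable_const _).indicator hT.compl)
          ((integrable_const _).indicator (hS.inter hT)), integral_indicator hT.compl,
          integral_indicator (hS.inter hT), setIntegral_const, setIntegral_const]
        simp
      -- The region that is free under `ν` is used up; the remaining level `p - τ` is spread evenly
      -- over the overlap, which has mass `1 - τ` under both laws.
      refine ⟨fun z => Tᶜ.indicator (fun _ => (1 : ℝ)) z
        + (S ∩ T).indicator (fun _ => (p - τ) / (1 - τ)) z,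
        (measurable_const.indicator hT.compl).add (measurable_const.indicator (hS.inter hT)),
        fun z => ?_, ?_, ?_⟩
      · have h0 : 0 ≤ (p - τ) / (1 - τ) := div_nonneg (by linarith) hτ1.le
        have h1 : (p - τ) / (1 - τ) ≤ 1 := (div_le_one hτ1).2 (by linarith [hp.2])
        by_cases hz : z ∈ T <;> by_cases hz' : z ∈ S <;> simp [hz, hz', h0, h1]
      · rw [key, ← hτ, hTS]; field_simp; ring
      · rw [key, hTS', measureReal_def, hν]; field_simp; simp
  · rintro v ⟨h, hm, h01, rfl, rfl⟩
    have hi : ∀ (m : Measure X) [IsProbabilityMeasure m], Integrable h m := fun m _ =>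
      integrable_of_mem_Icc m hm h01
    refine max_le (integral_nonneg fun z => (h01 z).1) ?_
    have h1 : ∫ z in Tᶜ, h z ∂μ ≤ τ := by
      calc ∫ z in Tᶜ, h z ∂μ ≤ ∫ _ in Tᶜ, (1 : ℝ) ∂μ :=
            integral_mono (hi μ).integrableOn (integrable_const _) fun z => (h01 z).2
        _ = τ := by simp [hτ]
    have h2 : ∫ z in T, h z ∂μ ≤ ∫ z, h z ∂ν := by
      rw [hST]
      exact setIntegral_le_integral (hi ν) (ae_of_all _ fun z => (h01 z).1)
    linarith [integral_add_compl hT (hi μ)]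

end General

/-! ### Inverted balls and axis shifts. -/

theorem invBall_lpBall {d : ℕ} (q : ℝ≥0∞) [Fact (1 ≤ q)] (r : ℝ) :
    invBall (lpBall (d := d) q r) = lpBall q r := by
  ext x y
  simp only [invBall, lpBall, Set.mem_ofPred_eq]
  rw [← neg_sub, WithLp.toLp_neg, norm_neg]

theorem invBall_sparseBall {d : ℕ} (ra rd : ℕ) :
    invBall (sparseBall (d := d) ra rd) = sparseBall rd ra := by
  ext x y
  simp only [invBall, sparseBall, Set.mem_ofPred_eq, and_comm]

theorem self_mem_lpBall {d : ℕ} (q : ℝ≥0∞) [Fact (1 ≤ q)] {r : ℝ} (hr : 0 ≤ r)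
    (x : Fin d → ℝ) : x ∈ lpBall q r x := by
  simp [lpBall, hr]

/-- A move by at most `r` along a coordinate axis stays in the ball. -/
theorem add_single_mem_lpBall {d : ℕ} (q : ℝ≥0∞) [Fact (1 ≤ q)] {r s : ℝ} (hs : |s| ≤ r)
    (x : Fin d → ℝ) (i : Fin d) : x + Pi.single i s ∈ lpBall q r x := by
  have := PiLp.norm_single (p := q) (β := fun _ : Fin d => ℝ) i s
  simpa [lpBall, this] using hs

/-! ### The distribution function of the centred Gaussian. -/

section CDF

variable {σ : ℝ≥0}

theorem sq_ne_zero_of_pos (hσ : 0 < σ) : σ ^ 2 ≠ 0 := pow_ne_zero 2 hσ.ne'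

theorem gaussCDF_eq_real (σ : ℝ≥0) (t : ℝ) :
    gaussCDF σ t = (gaussianReal 0 (σ ^ 2)).real (Set.Iic t) := cdf_eq_real _ _

theorem gaussCDF_strictMono (hσ : 0 < σ) : StrictMono (gaussCDF σ) := by
  intro s t hst
  have h : 0 < (gaussianReal 0 (σ ^ 2)).real (Set.Ioc s t) := by
    rw [measureReal_def, ENNReal.toReal_pos_iff]
    refine ⟨pos_iff_ne_zero.2 fun h0 => ?_, measure_lt_top _ _⟩
    have := gaussianReal_absolutelyContinuous' 0 (sq_ne_zero_of_pos hσ) h0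
    rw [Real.volume_Ioc, ENNReal.ofReal_eq_zero] at this
    linarith
  rw [gaussCDF_eq_real, gaussCDF_eq_real, ← Set.Iic_union_Ioc_eq_Iic hst.le,
    measureReal_union (Set.Iic_disjoint_Ioc le_rfl) measurableSet_Ioc]
  linarith

/-- The jump at `t` is the mass of `{t}`, and the law has no atoms. -/
theorem gaussCDF_continuous (hσ : 0 < σ) : Continuous (gaussCDF σ) := by
  have := nullSingletonClass_gaussianReal (μ := 0) (sq_ne_zero_of_pos hσ)
  refine continuous_iff_continuousAt.2 fun t => ?_
  have hm : Monotone (gaussCDF σ) := monotone_cdf _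
  refine hm.continuousAt_iff_leftLim_eq_rightLim.2 ?_
  have hr : Function.rightLim (gaussCDF σ) t = gaussCDF σ t :=
    (cdf (gaussianReal 0 (σ ^ 2))).rightLim_eq t
  have hl := (cdf (gaussianReal 0 (σ ^ 2))).measure_singleton t
  rw [measure_cdf, measure_singleton, eq_comm, ENNReal.ofReal_eq_zero] at hl
  rw [hr]
  refine le_antisymm (hm.leftLim_le le_rfl) ?_
  change gaussCDF σ t - Function.leftLim (gaussCDF σ) t ≤ 0 at hl
  linarith

theorem gaussQuantile_gaussCDF (hσ : 0 < σ) (t : ℝ) : gaussQuantile σ (gaussCDF σ t) = t := by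
  have : {s : ℝ | gaussCDF σ t ≤ gaussCDF σ s} = Set.Ici t := by
    ext s
    exact (gaussCDF_strictMono hσ).le_iff_le
  rw [gaussQuantile, this, csInf_Ici]

theorem exists_gaussCDF_eq (hσ : 0 < σ) {p : ℝ} (hp : p ∈ Set.Ioo (0 : ℝ) 1) :
    ∃ t, gaussCDF σ t = p := by
  refine mem_range_of_exists_le_of_exists_ge (gaussCDF_continuous hσ) ?_ ?_
  · exact (((tendsto_cdf_atBot (gaussianReal 0 (σ ^ 2))).eventually (gt_mem_nhds hp.1)).exists).imp
      fun _ h => le_of_lt h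
  · exact (((tendsto_cdf_atTop (gaussianReal 0 (σ ^ 2))).eventually (lt_mem_nhds hp.2)).exists).imp
      fun _ h => le_of_lt h

theorem gaussCDF_neg (hσ : 0 < σ) (t : ℝ) : gaussCDF σ (-t) = 1 - gaussCDF σ t := by
  have := nullSingletonClass_gaussianReal (μ := 0) (sq_ne_zero_of_pos hσ)
  have h := gaussianReal_map_neg (μ := 0) (v := σ ^ 2)
  rw [neg_zero] at h
  rw [gaussCDF_eq_real, gaussCDF_eq_real, ← probReal_compl_eq_one_sub measurableSet_Iic,
    Set.compl_Iic]
  nth_rw 1 [← h]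
  rw [map_measureReal_apply measurable_neg measurableSet_Iic]
  have : (fun x : ℝ => -x) ⁻¹' Set.Iic (-t) = Set.Ici t := by ext; simp
  rw [this]
  exact measureReal_congr Ioi_ae_eq_Ici.symm

end CDF

/-! ### Densities of products and of shifted Gaussians. -/

section Density

/-- On a box the product density times the indicator is a product of functions of single
coordinates, so its integral factors by independence. -/
theorem pi_withDensity {ι : Type*} [Fintype ι] {Ω : ι → Type*} [∀ i, MeasurableSpace (Ω i)]
    (μ : ∀ i, Measure (Ω i)) [∀ i, IsProbabilityMeasure (μ i)] {f : ∀ i, Ω i → ℝ≥0∞}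
    (hf : ∀ i, Measurable (f i)) [∀ i, SigmaFinite ((μ i).withDensity (f i))] :
    Measure.pi (fun i => (μ i).withDensity (f i))
      = (Measure.pi μ).withDensity fun z => ∏ i, f i (z i) := by
  refine Measure.pi_eq fun s hs => ?_
  rw [withDensity_apply _ (MeasurableSet.univ_pi hs), ← lintegral_indicator
    (MeasurableSet.univ_pi hs)]
  have h : ∀ z : ∀ i, Ω i, (Set.univ.pi s).indicator (fun z => ∏ i, f i (z i)) z
      = ∏ i, (s i).indicator (f i) (z i) := fun z => by
    classical
    by_cases hz : z ∈ Set.univ.pi s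
    · rw [Set.indicator_of_mem hz]
      exact Finset.prod_congr rfl fun i _ => (Set.indicator_of_mem (hz i trivial) _).symm
    · rw [Set.indicator_of_notMem hz]
      obtain ⟨i, hi⟩ : ∃ i, z i ∉ s i := by simpa using hz
      exact (Finset.prod_eq_zero (Finset.mem_univ i) (Set.indicator_of_notMem hi _)).symm
  have hm : ∀ i, Measurable ((s i).indicator (f i)) := fun i => (hf i).indicator (hs i)
  rw [lintegral_congr h, lintegral_prod_eq_prod_lintegral_of_indepFun Finset.univ
    (fun i (z : ∀ i, Ω i) => (s i).indicator (f i) (z i))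
    (iIndepFun_pi fun i => (hm i).aemeasurable) fun i => (hm i).comp (measurable_pi_apply i)]
  refine Finset.prod_congr rfl fun i _ => ?_
  rw [withDensity_apply _ (hs i), ← lintegral_indicator (hs i)]
  exact (measurePreserving_eval μ i).lintegral_comp (hm i)

theorem gaussianReal_add_eq_withDensity (m a : ℝ) {v : ℝ≥0} (hv : v ≠ 0) :
    gaussianReal (m + a) v = (gaussianReal m v).withDensity
      fun z => ENNReal.ofReal (Real.exp ((a * (z - m) - a ^ 2 / 2) / v)) := by
  rw [gaussianReal_of_var_ne_zero _ hv, gaussianReal_of_var_ne_zero _ hv,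
    ← withDensity_mul _ (measurable_gaussianPDF _ _) (by fun_prop)]
  congr 1
  ext1 z
  rw [Pi.mul_apply, gaussianPDF, gaussianPDF, ← ENNReal.ofReal_mul (gaussianPDFReal_nonneg _ _ _),
    gaussianPDFReal, gaussianPDFReal, mul_assoc (√_)⁻¹, ← Real.exp_add]
  congr 3
  have : (v : ℝ) ≠ 0 := by exact_mod_cast hv
  field_simp
  ring

end Density

/-! ### Gaussian smoothing. -/

section Scheme

variable {d : ℕ} {σ : ℝ≥0}

theorem gaussianScheme_eq_pi (σ : ℝ≥0) (x : Fin d → ℝ) :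
    gaussianScheme σ x = Measure.pi fun i => gaussianReal (x i) (σ ^ 2) := by
  have h : ∀ i, (gaussianReal 0 (σ ^ 2)).map (fun e => x i + e) = gaussianReal (x i) (σ ^ 2) :=
    fun i => by rw [gaussianReal_map_const_add, zero_add]
  have hs : ∀ i, SigmaFinite ((gaussianReal 0 (σ ^ 2)).map fun e => x i + e) := fun i => by
    rw [h]; infer_instance
  have := Measure.pi_map_pi (μ := fun _ : Fin d => gaussianReal 0 (σ ^ 2))
    (f := fun i e => x i + e) (fun i => by fun_prop)
  simp only [h] at this
  exact this

instance (x : Fin d → ℝ) : IsProbabilityMeasure (gaussianScheme σ x) := by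
  rw [gaussianScheme_eq_pi]; infer_instance

theorem gaussianScheme_add_eq_withDensity (hσ : 0 < σ) (x a : Fin d → ℝ) :
    gaussianScheme σ (x + a) = (gaussianScheme σ x).withDensity fun z => ENNReal.ofReal
      (Real.exp (∑ i, (a i * (z i - x i) - a i ^ 2 / 2) / ((σ ^ 2 : ℝ≥0) : ℝ))) := by
  have h := fun i => gaussianReal_add_eq_withDensity (x i) (a i) (sq_ne_zero_of_pos hσ)
  have hs : ∀ i, SigmaFinite ((gaussianReal (x i) (σ ^ 2)).withDensity fun z =>
      ENNReal.ofReal (Real.exp ((a i * (z - x i) - a i ^ 2 / 2) / ((σ ^ 2 : ℝ≥0) : ℝ)))) :=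
    fun i => by rw [← h]; infer_instance
  rw [gaussianScheme_eq_pi, gaussianScheme_eq_pi]
  simp only [Pi.add_apply, h]
  rw [pi_withDensity _ fun i => by fun_prop]
  congr 1
  ext1 z
  rw [Real.exp_sum, ENNReal.ofReal_prod_of_nonneg fun i _ => (Real.exp_pos _).le]

theorem gaussianScheme_absolutelyContinuous (hσ : 0 < σ) (x x' : Fin d → ℝ) :
    gaussianScheme σ x' ≪ gaussianScheme σ x := by
  have := gaussianScheme_add_eq_withDensity hσ x (x' - x)
  rw [add_sub_cancel] at this
  rw [this]
  exact withDensity_absolutelyContinuous _ _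

/-- Characteristic functions: that of the projection at `t` is that of the product law at `t • u`,
where the exponents add up through `∑ u i ^ 2 = 1`. -/
theorem map_sum_mul_pi_gaussianReal (σ : ℝ≥0) {u : Fin d → ℝ} (hu : ∑ i, u i ^ 2 = 1) :
    (Measure.pi fun _ : Fin d => gaussianReal 0 (σ ^ 2)).map (fun e => ∑ i, u i * e i)
      = gaussianReal 0 (σ ^ 2) := by
  have hm : Measurable fun e : Fin d → ℝ => ∑ i, u i * e i := by fun_prop
  have : IsProbabilityMeasure ((Measure.pi fun _ : Fin d => gaussianReal 0 (σ ^ 2)).map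
      fun e => ∑ i, u i * e i) := Measure.isProbabilityMeasure_map hm.aemeasurable
  refine Measure.ext_of_charFun (funext fun t => ?_)
  have h := charFun_pi (μ := fun _ : Fin d => gaussianReal 0 (σ ^ 2)) (WithLp.toLp 2 (t • u))
  rw [charFun_apply, integral_map (by fun_prop) (by fun_prop)] at h
  rw [charFun_apply, integral_map hm.aemeasurable (by fun_prop)]
  have hl : ∀ e : Fin d → ℝ, inner ℝ (∑ i, u i * e i) t
      = inner ℝ (WithLp.toLp 2 e) (WithLp.toLp 2 (t • u)) := fun e => by
    simp only [PiLp.inner_apply, Pi.smul_apply, smul_eq_mul, RCLike.inner_apply, conj_trivial,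
      Finset.mul_sum]
    exact Finset.sum_congr rfl fun i _ => by ring
  simp only [hl]
  rw [h]
  simp only [charFun_gaussianReal]
  rw [← Complex.exp_sum]
  congr 1
  simp only [Pi.smul_apply, smul_eq_mul, Complex.ofReal_zero, mul_zero, zero_mul, zero_sub,
    Complex.ofReal_mul, mul_pow, Finset.sum_neg_distrib, ← Finset.sum_div]
  rw [← Finset.mul_sum, ← Finset.mul_sum]
  have : ∑ i, (u i : ℂ) ^ 2 = 1 := by exact_mod_cast hu
  rw [this, mul_one]

/-- The mass of a half-space with unit normal `u` under noise centred at `x + n • u`. -/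
theorem gaussianScheme_real_halfSpace (σ : ℝ≥0) (x : Fin d → ℝ) {u : Fin d → ℝ}
    (hu : ∑ i, u i ^ 2 = 1) (n t : ℝ) :
    (gaussianScheme σ (x + n • u)).real {z | ∑ i, u i * (z i - x i) ≤ t}
      = gaussCDF σ (t - n) := by
  have hm : MeasurableSet {z : Fin d → ℝ | ∑ i, u i * (z i - x i) ≤ t} :=
    measurableSet_le (by fun_prop) (by fun_prop)
  rw [gaussCDF_eq_real, ← map_sum_mul_pi_gaussianReal σ hu, gaussianScheme,
    map_measureReal_apply (by fun_prop) hm,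
    map_measureReal_apply (by fun_prop) measurableSet_Iic]
  congr 1
  ext e
  have : ∑ i, u i * ((x + n • u + e) i - x i) = n + ∑ i, u i * e i := by
    have h1 : ∀ i, u i * ((x + n • u + e) i - x i) = n * u i ^ 2 + u i * e i := fun i => by
      simp only [Pi.add_apply, Pi.smul_apply, smul_eq_mul]; ring
    rw [Finset.sum_congr rfl fun i _ => h1 i, Finset.sum_add_distrib, ← Finset.mul_sum, hu,
      mul_one]
  simp only [Set.mem_preimage, Set.mem_ofPred_eq, Set.mem_Iic, this]
  exact (le_sub_iff_add_le').symm

/-- The log-likelihood ratio is affine in `∑ u i * (z i - x i)` with slope of the sign of `n ≥ 0`,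
so the half-space is a Neyman–Pearson region. The threshold `k` is the ratio on its boundary. -/
theorem gaussCDF_le_of_mem_testValues (hσ : 0 < σ) (x : Fin d → ℝ) {u : Fin d → ℝ}
    (hu : ∑ i, u i ^ 2 = 1) {n : ℝ} (hn : 0 ≤ n) {t v : ℝ}
    (hv : v ∈ testValues (gaussianScheme σ x) (gaussianScheme σ (x + n • u)) (gaussCDF σ t)) :
    gaussCDF σ (t - n) ≤ v := by
  have hm : MeasurableSet {z : Fin d → ℝ | ∑ i, u i * (z i - x i) ≤ t} :=
    measurableSet_le (by fun_prop) (by fun_prop)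
  have hσ2 : (0 : ℝ) < ((σ ^ 2 : ℝ≥0) : ℝ) := by positivity
  have h0 := gaussianScheme_real_halfSpace σ x hu 0 t
  rw [zero_smul, add_zero, sub_zero] at h0
  rw [← h0] at hv
  rw [← gaussianScheme_real_halfSpace σ x hu]
  have hexp : ∀ z : Fin d → ℝ,
      ∑ i, ((n • u) i * (z i - x i) - (n • u) i ^ 2 / 2) / ((σ ^ 2 : ℝ≥0) : ℝ)
        = (n * ∑ i, u i * (z i - x i) - n ^ 2 / 2) / ((σ ^ 2 : ℝ≥0) : ℝ) := fun z => by
    rw [← Finset.sum_div, Finset.sum_sub_distrib, ← Finset.sum_div, Finset.mul_sum]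
    simp only [Pi.smul_apply, smul_eq_mul, mul_pow, ← Finset.mul_sum, hu, mul_one, mul_assoc]
  refine measureReal_le_of_mem_testValues (by fun_prop) (fun z => (Real.exp_pos _).le)
    (gaussianScheme_add_eq_withDensity hσ x (n • u)) hm
    (k := Real.exp ((n * t - n ^ 2 / 2) / ((σ ^ 2 : ℝ≥0) : ℝ))) (fun z hz => ?_)
    (fun z hz => ?_) hv
  · rw [hexp]
    have : ∑ i, u i * (z i - x i) ≤ t := hz
    gcongr
  · rw [hexp]
    have : t ≤ ∑ i, u i * (z i - x i) := le_of_lt (not_le.1 hz)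
    gcongr

theorem norm_toLp_two_le_norm_toLp_one (a : Fin d → ℝ) :
    ‖WithLp.toLp 2 a‖ ≤ ‖WithLp.toLp 1 a‖ := by
  rw [EuclideanSpace.norm_eq, PiLp.norm_eq_of_L1]
  refine Real.sqrt_le_iff.2 ⟨Finset.sum_nonneg fun i _ => norm_nonneg _, ?_⟩
  exact Finset.sum_sq_le_sq_sum_of_nonneg fun i _ => norm_nonneg _

theorem exists_eq_add_smul_of_mem_lpBall (hd : 0 < d) {q : ℝ≥0∞} (hq : q = 1 ∨ q = 2) {r : ℝ}
    {x x' : Fin d → ℝ} (hx' : x' ∈ lpBall q r x) :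
    ∃ (u : Fin d → ℝ) (n : ℝ), ∑ i, u i ^ 2 = 1 ∧ 0 ≤ n ∧ n ≤ r ∧ x' = x + n • u := by
  have hle : ‖WithLp.toLp 2 (x' - x)‖ ≤ r := by
    rcases hq with rfl | rfl
    · exact (norm_toLp_two_le_norm_toLp_one _).trans hx'
    · exact hx'
  set n := ‖WithLp.toLp 2 (x' - x)‖ with hn
  rcases eq_or_ne n 0 with h0 | h0
  -- Without displacement any unit vector serves as direction; its existence needs `0 < d`.
  · refine ⟨Pi.single ⟨0, hd⟩ 1, n, ?_, norm_nonneg _, hle, ?_⟩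
    · simp [Pi.single_apply]
    · have : WithLp.toLp 2 (x' - x) = 0 := norm_eq_zero.1 (hn ▸ h0)
      rw [WithLp.toLp_eq_zero, sub_eq_zero] at this
      simp [h0, this]
  · refine ⟨n⁻¹ • (x' - x), n, ?_, norm_nonneg _, hle, ?_⟩
    · have : n ^ 2 = ∑ i, (x' - x) i ^ 2 := by
        rw [hn, EuclideanSpace.norm_sq_eq]; simp
      simp only [Pi.smul_apply, smul_eq_mul, mul_pow, ← Finset.mul_sum]
      rw [← this]; field_simp
    · rw [smul_smul, mul_inv_cancel₀ h0, one_smul, add_sub_cancel]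

/-- A shift by `r` along an axis has length `r` in both norms and attains the bound with a
half-space test. Any other point of the ball lies at Euclidean distance at most `r`, hence does no
worse. -/
theorem isLeast_certValues_gaussian (hσ : 0 < σ) (hd : 0 < d) {q : ℝ≥0∞} (hq : q = 1 ∨ q = 2)
    {r : ℝ} (hr : 0 ≤ r) (x : Fin d → ℝ) (t : ℝ) :
    IsLeast (certValues (gaussianScheme σ) (lpBall q r) x (gaussCDF σ t))
      (gaussCDF σ (t - r)) := by
  constructor
  · have hu : ∑ i, (Pi.single ⟨0, hd⟩ 1 : Fin d → ℝ) i ^ 2 = 1 := by simp [Pi.single_apply]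
    have hm : MeasurableSet {z : Fin d → ℝ |
        ∑ i, (Pi.single ⟨0, hd⟩ 1 : Fin d → ℝ) i * (z i - x i) ≤ t} :=
      measurableSet_le (by fun_prop) (by fun_prop)
    have h := gaussianScheme_real_halfSpace σ x hu
    refine ⟨x + r • Pi.single ⟨0, hd⟩ 1, ?_,
      Set.indicator {z : Fin d → ℝ |
        ∑ i, (Pi.single ⟨0, hd⟩ 1 : Fin d → ℝ) i * (z i - x i) ≤ t} (fun _ => 1),
      measurable_const.indicator hm, fun z => ?_, ?_, ?_⟩
    · have : Fact (1 ≤ q) := ⟨by rcases hq with rfl | rfl <;> norm_num⟩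
      have := add_single_mem_lpBall q (abs_of_nonneg hr).le x ⟨0, hd⟩
      rwa [← mul_one r, ← smul_eq_mul, Pi.single_smul, smul_eq_mul, mul_one] at this
    · classical
      rw [Set.indicator_apply]
      split_ifs <;> simp
    · have h0 := h 0 t
      rw [zero_smul, add_zero, sub_zero] at h0
      rw [← h0, integral_indicator hm]; simp
    · rw [← h r t, integral_indicator hm]; simp
  · rintro v ⟨x', hx', hv⟩
    obtain ⟨u, n, hu, hn, hnr, rfl⟩ := exists_eq_add_smul_of_mem_lpBall hd hq hx'
    exact ((gaussCDF_strictMono hσ).monotone (by linarith)).trans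
      (gaussCDF_le_of_mem_testValues hσ x hu hn hv)

theorem isGreatest_certValues_gaussian (hσ : 0 < σ) (hd : 0 < d) {q : ℝ≥0∞}
    (hq : q = 1 ∨ q = 2) {r : ℝ} (hr : 0 ≤ r) (x : Fin d → ℝ) (t : ℝ) :
    IsGreatest (certValues (gaussianScheme σ) (lpBall q r) x (gaussCDF σ t))
      (gaussCDF σ (t + r)) := by
  have h := isLeast_certValues_gaussian hσ hd hq hr x (-t)
  rw [gaussCDF_neg hσ] at h
  have h' := isGreatest_certValues_of_isLeast h
  rwa [← gaussCDF_neg hσ, neg_sub, sub_neg_eq_add, add_comm] at h'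

theorem certLower_certUpper_gaussian (hσ : 0 < σ) {q : ℝ≥0∞} (hq : q = 1 ∨ q = 2) {r : ℝ}
    (hr : 0 ≤ r) (x y : Fin d → ℝ) {p : ℝ} (hp : p ∈ Set.Icc (0 : ℝ) 1) :
    certLower (gaussianScheme σ) (lpBall q r) x
      (certUpper (gaussianScheme σ) (invBall (lpBall q r)) y p) = p := by
  have : Fact (1 ≤ q) := ⟨by rcases hq with rfl | rfl <;> norm_num⟩
  rw [invBall_lpBall]
  -- The degenerate cases `d = 0`, `p = 0` and `p = 1` are settled together: in each of them `p` is
  -- the only attainable value.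
  by_cases h : ∀ z : Fin d → ℝ, certValues (gaussianScheme σ) (lpBall q r) z p = {p}
  · rw [certUpper, h, csSup_singleton, certLower, h, csInf_singleton]
  obtain ⟨z, hz⟩ := not_forall.1 h
  have hself := self_mem_lpBall q hr z
  have hd : 0 < d := by
    refine Nat.pos_of_ne_zero ?_
    rintro rfl
    exact hz (certValues_eq_singleton_of_subsingleton hself hp)
  have hp' : p ∈ Set.Ioo (0 : ℝ) 1 := by
    refine ⟨lt_of_le_of_ne hp.1 ?_, lt_of_le_of_ne hp.2 ?_⟩ <;> rintro rfl
    · exact hz (certValues_eq_singleton hself hp fun x' _ v hv =>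
        eq_zero_of_mem_testValues_zero (gaussianScheme_absolutelyContinuous hσ _ _) hv)
    · exact hz (certValues_eq_singleton hself hp fun x' _ v hv =>
        eq_one_of_mem_testValues_one (gaussianScheme_absolutelyContinuous hσ _ _) hv)
  obtain ⟨t, rfl⟩ := exists_gaussCDF_eq hσ hp'
  rw [certUpper, (isGreatest_certValues_gaussian hσ hd hq hr y t).csSup_eq, certLower,
    (isLeast_certValues_gaussian hσ hd hq hr x (t + r)).csInf_eq, add_sub_cancel_right]

end Scheme

/-! ### Uniform smoothing. -/

section Uniform

variable {d : ℕ} {l : ℝ}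

/-- The uniform distribution on `[0, 2l]`. -/
abbrev unifNoise (l : ℝ) : Measure ℝ := cond (volume : Measure ℝ) (Set.Icc 0 (2 * l))

theorem isProbabilityMeasure_unifNoise (hl : 0 < l) : IsProbabilityMeasure (unifNoise l) := by
  refine cond_isProbabilityMeasure_of_finite ?_ ?_ <;> rw [Real.volume_Icc] <;>
    simp [hl, -ENNReal.ofReal_mul]

theorem unifNoise_real_apply (hl : 0 < l) (s : Set ℝ) :
    (unifNoise l).real s = volume.real (Set.Icc 0 (2 * l) ∩ s) / (2 * l) := by
  rw [measureReal_def, cond_apply measurableSet_Icc, ENNReal.toReal_mul, ENNReal.toReal_inv,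
    ← measureReal_def, ← measureReal_def, Real.volume_real_Icc_of_le (by linarith), sub_zero,
    div_eq_inv_mul]

/-- The support `∏ [x i, x i + 2l]` of the noise around `x`. -/
def cube (l : ℝ) (x : Fin d → ℝ) : Set (Fin d → ℝ) :=
  Set.univ.pi fun i => Set.Icc (x i) (x i + 2 * l)

theorem measurableSet_cube (l : ℝ) (x : Fin d → ℝ) : MeasurableSet (cube l x) :=
  MeasurableSet.univ_pi fun _ => measurableSet_Icc

theorem preimage_add_cube (l : ℝ) (x x' : Fin d → ℝ) :
    (fun e => x + e) ⁻¹' cube l x' = cube l (x' - x) := by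
  ext e
  simp only [cube, Set.mem_preimage, Set.mem_univ_pi, Set.mem_Icc, Pi.add_apply, Pi.sub_apply]
  refine forall_congr' fun i => ⟨fun h => ⟨?_, ?_⟩, fun h => ⟨?_, ?_⟩⟩ <;> linarith [h.1, h.2]

theorem pi_unifNoise_eq (hl : 0 < l) :
    Measure.pi (fun _ : Fin d => unifNoise l)
      = (ENNReal.ofReal (2 * l))⁻¹ ^ d • volume.restrict (cube l 0) := by
  have := isProbabilityMeasure_unifNoise hl
  refine Measure.pi_eq fun s hs => ?_
  rw [Measure.smul_apply, Measure.restrict_apply (MeasurableSet.univ_pi hs), cube,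
    ← Set.pi_inter_distrib, volume_pi, Measure.pi_pi, smul_eq_mul]
  simp only [cond_apply measurableSet_Icc, Finset.prod_mul_distrib, Finset.prod_const,
    Finset.card_univ, Fintype.card_fin, Real.volume_Icc, sub_zero, Pi.zero_apply, zero_add,
    Set.inter_comm]

theorem uniformScheme_eq (hl : 0 < l) (x : Fin d → ℝ) :
    uniformScheme l x = (ENNReal.ofReal (2 * l))⁻¹ ^ d • volume.restrict (cube l x) := by
  have h : cube l 0 = (fun e => x + e) ⁻¹' cube l x := by rw [preimage_add_cube, sub_self]
  have hm : Measurable fun e : Fin d → ℝ => x + e := by fun_prop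
  change (Measure.pi fun _ : Fin d => unifNoise l).map _ = _
  rw [pi_unifNoise_eq hl, Measure.map_smul, h,
    ← Measure.restrict_map hm (measurableSet_cube l x), map_add_left_eq_self]

theorem isProbabilityMeasure_uniformScheme (hl : 0 < l) (x : Fin d → ℝ) :
    IsProbabilityMeasure (uniformScheme l x) := by
  have := isProbabilityMeasure_unifNoise hl
  exact Measure.isProbabilityMeasure_map (by fun_prop)

/-- The mass of the noise that leaves its support under a shift by `-δ`: the total variation
distance of the noise distributions around two points that differ by `δ`. -/
def overhang (l : ℝ) (δ : Fin d → ℝ) : ℝ :=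
  (Measure.pi fun _ : Fin d => unifNoise l).real (cube l δ)ᶜ

theorem uniformScheme_real_compl_cube (l : ℝ) (x x' : Fin d → ℝ) :
    (uniformScheme l x).real (cube l x')ᶜ = overhang l (x' - x) := by
  rw [uniformScheme, map_measureReal_apply (by fun_prop) (measurableSet_cube l x').compl,
    Set.preimage_compl, preimage_add_cube]
  rfl

/-- Both laws have the same constant density on their cubes, hence agree on the intersection. The
bound depends on the displacement only. -/
theorem isLeast_testValues_uniform (hl : 0 < l) (x x' : Fin d → ℝ) {p : ℝ}
    (hp : p ∈ Set.Icc (0 : ℝ) 1) :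
    IsLeast (testValues (uniformScheme l x) (uniformScheme l x') p)
      (max 0 (p - overhang l (x' - x))) := by
  have := isProbabilityMeasure_uniformScheme hl x
  have := isProbabilityMeasure_uniformScheme hl x'
  rw [← uniformScheme_real_compl_cube]
  have h0 : ∀ y : Fin d → ℝ, uniformScheme l y (cube l y)ᶜ = 0 := fun y => by
    rw [uniformScheme_eq hl, Measure.smul_apply, Measure.restrict_apply
      (measurableSet_cube l y).compl]
    simp
  refine isLeast_testValues_of_restrict_eq (measurableSet_cube l x) (measurableSet_cube l x')
    (h0 x) (h0 x') ?_ hp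
  rw [uniformScheme_eq hl, uniformScheme_eq hl, Measure.restrict_smul, Measure.restrict_smul,
    Measure.restrict_restrict (measurableSet_cube l _),
    Measure.restrict_restrict (measurableSet_cube l _), Set.inter_comm]

theorem isGreatest_testValues_uniform (hl : 0 < l) (x x' : Fin d → ℝ) {p : ℝ}
    (hp : p ∈ Set.Icc (0 : ℝ) 1) :
    IsGreatest (testValues (uniformScheme l x) (uniformScheme l x') p)
      (min 1 (p + overhang l (x' - x))) := by
  have := isProbabilityMeasure_uniformScheme hl x
  have := isProbabilityMeasure_uniformScheme hl x'
  have h := isGreatest_testValues_of_isLeast (isLeast_testValues_uniform hl x x' (p := 1 - p)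
    ⟨by linarith [hp.2], by linarith [hp.1]⟩)
  convert h using 1
  rw [← min_sub_sub_left, sub_zero]
  congr 1
  ring

/-- The certified bounds invert each other as long as the upper bound is not clipped. -/
theorem certLower_certUpper_uniform (hl : 0 < l) {q : ℝ≥0∞} [Fact (1 ≤ q)] {r : ℝ} (hr : 0 ≤ r)
    (x y : Fin d → ℝ) {p : ℝ} (hp : p ∈ Set.Icc (0 : ℝ) 1)
    (h1 : certUpper (uniformScheme l) (lpBall q r) y p < 1) :
    certLower (uniformScheme l) (lpBall q r) x
      (certUpper (uniformScheme l) (lpBall q r) y p) = p := by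
  have hprob : ∀ z : Fin d → ℝ, IsProbabilityMeasure (uniformScheme l z) :=
    isProbabilityMeasure_uniformScheme hl
  set P := certUpper (uniformScheme l) (lpBall q r) y p with hP
  have hbdd := bddAbove_certValues (uniformScheme l) (lpBall q r) y p
  have hpP : p ≤ P := le_csSup hbdd ⟨y, self_mem_lpBall q hr y, self_mem_testValues _ _ hp⟩
  have hP01 : P ∈ Set.Icc (0 : ℝ) 1 := ⟨hp.1.trans hpP, h1.le⟩
  -- Since `P < 1`, no displacement in the ball is clipped at `y`, so each `overhang` is at most `P
  -- - p`.
  have hover : ∀ δ : Fin d → ℝ, ‖WithLp.toLp q δ‖ ≤ r → p ≤ P - overhang l δ := fun δ hδ => by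
    have hmem : y + δ ∈ lpBall q r y := by simpa [lpBall] using hδ
    have h := le_csSup hbdd ⟨y + δ, hmem, (isGreatest_testValues_uniform hl y (y + δ) hp).1⟩
    rw [add_sub_cancel_left] at h
    rcases min_le_iff.1 h with h | h
    · exact absurd h (not_le.2 h1)
    · change _ ≤ P at h
      linarith
  refine le_antisymm (le_of_forall_pos_le_add fun ε hε => ?_) ?_
  -- The supremum is only approached: a displacement within `ε` of optimal at `y` is reused at `x`.
  · obtain ⟨v, ⟨y', hy', hv⟩, hlt⟩ := exists_lt_of_lt_csSup
      ⟨p, mem_certValues.2 ⟨y, self_mem_lpBall q hr y, self_mem_testValues _ _ hp⟩⟩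
      (show P - ε < sSup (certValues (uniformScheme l) (lpBall q r) y p) from
        sub_lt_self _ hε)
    have hle := ((isGreatest_testValues_uniform hl y y' hp).2 hv).trans (min_le_right _ _)
    have hmem : x + (y' - y) ∈ lpBall q r x := by simpa [lpBall] using hy'
    have h := csInf_le (bddBelow_certValues (uniformScheme l) (lpBall q r) x P)
      ⟨_, hmem, (isLeast_testValues_uniform hl x (x + (y' - y)) hP01).1⟩
    rw [add_sub_cancel_left, max_eq_right (hp.1.trans (hover _ hy'))] at h
    refine h.trans ?_
    linarith
  · refine le_csInf ⟨P, mem_certValues.2 ⟨x, self_mem_lpBall q hr x,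
      self_mem_testValues _ _ hP01⟩⟩ ?_
    rintro v ⟨x', hx', hv⟩
    exact (hover _ hx').trans
      ((le_max_right _ _).trans ((isLeast_testValues_uniform hl x x' hP01).2 hv))

theorem unifNoise_real_compl_Icc_le (hl : 0 < l) (s : ℝ) :
    (unifNoise l).real (Set.Icc s (s + 2 * l))ᶜ ≤ |s| / (2 * l) := by
  rw [unifNoise_real_apply hl]
  gcongr
  rcases le_total 0 s with hs | hs
  · calc volume.real (Set.Icc 0 (2 * l) ∩ (Set.Icc s (s + 2 * l))ᶜ)
        ≤ volume.real (Set.Ico 0 s) := by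
          refine measureReal_mono (fun z hz => ⟨hz.1.1, ?_⟩) (by simp)
          by_contra! h
          exact hz.2 ⟨h, by linarith [hz.1.2]⟩
      _ = |s| := by rw [Real.volume_real_Ico_of_le hs, abs_of_nonneg hs, sub_zero]
  · calc volume.real (Set.Icc 0 (2 * l) ∩ (Set.Icc s (s + 2 * l))ᶜ)
        ≤ volume.real (Set.Ioc (s + 2 * l) (2 * l)) := by
          refine measureReal_mono (fun z hz => ⟨?_, hz.1.2⟩) (by simp)
          by_contra! h
          exact hz.2 ⟨by linarith [hz.1.1], h⟩
      _ = |s| := by rw [Real.volume_real_Ioc_of_le (by linarith), abs_of_nonpos hs]; ring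

/-- Leaving the shifted cube means leaving one of its sides: a union bound over the coordinates. -/
theorem overhang_le (hl : 0 < l) (δ : Fin d → ℝ) :
    overhang l δ ≤ ‖WithLp.toLp 1 δ‖ / (2 * l) := by
  have := isProbabilityMeasure_unifNoise hl
  have hsub : (cube l δ)ᶜ ⊆ ⋃ i, Function.eval i ⁻¹' (Set.Icc (δ i) (δ i + 2 * l))ᶜ := by
    intro e he
    by_contra hc
    simp only [Set.mem_iUnion, Set.mem_preimage, Function.eval, Set.mem_compl_iff, not_exists,
      not_not] at hc
    exact he fun i _ => hc i
  calc overhang l δ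
      ≤ ∑ i, (Measure.pi fun _ : Fin d => unifNoise l).real
          (Function.eval i ⁻¹' (Set.Icc (δ i) (δ i + 2 * l))ᶜ) :=
        (measureReal_mono hsub).trans (measureReal_iUnion_fintype_le _)
    _ ≤ ∑ i, |δ i| / (2 * l) := Finset.sum_le_sum fun i _ => by
        rw [measureReal_def, (measurePreserving_eval (fun _ : Fin d => unifNoise l)
          i).measure_preimage measurableSet_Icc.compl.nullMeasurableSet]
        exact unifNoise_real_compl_Icc_le hl (δ i)
    _ = ‖WithLp.toLp 1 δ‖ / (2 * l) := by
        rw [PiLp.norm_eq_of_L1, Finset.sum_div]; rfl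

theorem overhang_single (hl : 0 < l) (i : Fin d) {s : ℝ} (hs : 0 ≤ s) (hsl : s ≤ 2 * l) :
    overhang l (Pi.single i s) = s / (2 * l) := by
  have := isProbabilityMeasure_unifNoise hl
  refine le_antisymm ((overhang_le hl _).trans_eq ?_) ?_
  · have := PiLp.norm_single (p := 1) (β := fun _ : Fin d => ℝ) i s
    rw [PiLp.toLp_single, this, Real.norm_of_nonneg hs]
  · have hset : Set.Icc 0 (2 * l) ∩ Set.Iio s = Set.Ico 0 s := by
      ext z
      simp only [Set.mem_inter_iff, Set.mem_Icc, Set.mem_Iio, Set.mem_Ico]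
      exact ⟨fun h => ⟨h.1.1, h.2⟩, fun h => ⟨⟨h.1, by linarith⟩, h.2⟩⟩
    have hval : (unifNoise l).real (Set.Iio s) = s / (2 * l) := by
      rw [unifNoise_real_apply hl, hset, Real.volume_real_Ico_of_le hs, sub_zero]
    rw [← hval, measureReal_def, ← (measurePreserving_eval (fun _ : Fin d => unifNoise l)
      i).measure_preimage measurableSet_Iio.nullMeasurableSet, ← measureReal_def]
    refine measureReal_mono fun e he hc => ?_
    have h1 : e i < s := he
    have h2 := (hc i trivial).1
    simp at h2
    linarith

theorem isLeast_certValues_uniform (hl : 0 < l) {r : ℝ} (hr : 0 ≤ r) (hd : 0 < d)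
    (x : Fin d → ℝ) {p : ℝ} (hp : p ∈ Set.Icc (0 : ℝ) 1) :
    IsLeast (certValues (uniformScheme l) (lpBall 1 r) x p) (max 0 (lipLower l r p)) := by
  have hl2 : 0 < 2 * l := by linarith
  constructor
  -- Beyond a shift of `2 * l` the `overhang` has already reached 1, so the shift is truncated
  -- there; both lower bounds are then clipped to 0.
  · have hs0 : 0 ≤ min r (2 * l) := le_min hr hl2.le
    have hmem := add_single_mem_lpBall 1 (s := min r (2 * l)) (r := r)
      (by rw [abs_of_nonneg hs0]; exact min_le_left _ _) x ⟨0, hd⟩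
    have h := (isLeast_testValues_uniform hl x (x + Pi.single ⟨0, hd⟩ (min r (2 * l))) hp).1
    rw [add_sub_cancel_left, overhang_single hl _ hs0 (min_le_right _ _)] at h
    refine mem_certValues.2 ⟨_, hmem, ?_⟩
    convert h using 1
    rw [lipLower]
    rcases le_total r (2 * l) with hrl | hrl
    · rw [min_eq_left hrl]
    · rw [min_eq_right hrl, div_self hl2.ne', max_eq_left, max_eq_left (by linarith [hp.2])]
      exact sub_nonpos.2 (hp.2.trans ((one_le_div hl2).2 hrl))
  · rintro v ⟨x', hx', hv⟩
    refine le_trans ?_ ((isLeast_testValues_uniform hl x x' hp).2 hv)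
    refine max_le_max le_rfl (sub_le_sub_left ((overhang_le hl _).trans ?_) p)
    have : ‖WithLp.toLp 1 (x' - x)‖ ≤ r := hx'
    gcongr

theorem isGreatest_certValues_uniform (hl : 0 < l) {r : ℝ} (hr : 0 ≤ r) (hd : 0 < d)
    (x : Fin d → ℝ) {p : ℝ} (hp : p ∈ Set.Icc (0 : ℝ) 1) :
    IsGreatest (certValues (uniformScheme l) (lpBall 1 r) x p) (min 1 (lipUpper l r p)) := by
  have : ∀ z : Fin d → ℝ, IsProbabilityMeasure (uniformScheme l z) :=
    isProbabilityMeasure_uniformScheme hl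
  have h := isGreatest_certValues_of_isLeast (isLeast_certValues_uniform hl hr hd x (p := 1 - p)
    ⟨by linarith [hp.2], by linarith [hp.1]⟩)
  convert h using 1
  rw [← min_sub_sub_left, sub_zero, lipUpper, lipLower]
  congr 1
  ring

theorem lipLower_lipUpper (l r p : ℝ) : lipLower l r (lipUpper l r p) = p :=
  add_sub_cancel_right _ _

theorem certLower_certUpper_uniform_one (hl : 0 < l) {r : ℝ} (hr : 0 ≤ r) (x y : Fin d → ℝ)
    {p : ℝ} (hp : p ∈ Set.Icc (0 : ℝ) 1) (h1 : lipUpper l r p ≤ 1) :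
    certLower (uniformScheme l) (lpBall 1 r) x
      (certUpper (uniformScheme l) (lpBall 1 r) y p) = p := by
  have : ∀ z : Fin d → ℝ, IsProbabilityMeasure (uniformScheme l z) :=
    isProbabilityMeasure_uniformScheme hl
  rcases Nat.eq_zero_or_pos d with rfl | hd
  · rw [certUpper, certValues_eq_singleton_of_subsingleton (self_mem_lpBall 1 hr y) hp,
      csSup_singleton, certLower,
      certValues_eq_singleton_of_subsingleton (self_mem_lpBall 1 hr x) hp, csInf_singleton]
  · have h0 : 0 ≤ lipUpper l r p := add_nonneg hp.1 (div_nonneg hr (by linarith))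
    rw [certUpper, (isGreatest_certValues_uniform hl hr hd y hp).csSup_eq, min_eq_right h1,
      certLower, (isLeast_certValues_uniform hl hr hd x ⟨h0, h1⟩).csInf_eq, lipLower_lipUpper,
      max_eq_right hp.1]

end Uniform

/-! ### Splitting noise. -/

section Split

variable {d : ℕ} {l : ℝ}

/-- If two random points differ only on `D`, the expectations of a test differ by at most the
probability of `D`. -/
theorem integral_map_le_integral_map_add {Ω X : Type*} [MeasurableSpace Ω] [MeasurableSpace X]
    (ν : Measure Ω) [IsProbabilityMeasure ν] {f g : Ω → X} (hf : Measurable f)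
    (hg : Measurable g) {D : Set Ω} (hD : MeasurableSet D) (hfg : ∀ s ∉ D, f s = g s)
    {h : X → ℝ} (hm : Measurable h) (h01 : ∀ z, h z ∈ Set.Icc (0 : ℝ) 1) :
    ∫ z, h z ∂(ν.map f) ≤ ∫ z, h z ∂(ν.map g) + ν.real D := by
  rw [integral_map hf.aemeasurable hm.aestronglyMeasurable,
    integral_map hg.aemeasurable hm.aestronglyMeasurable]
  have hgi : Integrable (fun s => h (g s)) ν :=
    integrable_of_mem_Icc ν (hm.comp hg) fun z => h01 (g z)
  have hDi : Integrable (D.indicator fun _ => (1 : ℝ)) ν := (integrable_const _).indicator hD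
  calc ∫ s, h (f s) ∂ν ≤ ∫ s, (h (g s) + D.indicator (fun _ => (1 : ℝ)) s) ∂ν := by
        refine integral_mono (integrable_of_mem_Icc ν (hm.comp hf) fun z => h01 (f z))
          (hgi.add hDi) fun s => ?_
        by_cases hs : s ∈ D
        · simp only [Set.indicator_of_mem hs]
          linarith [(h01 (f s)).2, (h01 (g s)).1]
        · simp [Set.indicator_of_notMem hs, hfg s hs]
    _ = ∫ s, h (g s) ∂ν + ν.real D := by
        rw [integral_add hgi hDi, integral_indicator hD]; simp

/-- A uniformly shifted grid of mesh `2l` separates `a` and `b` with probability at most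
`|b - a| / (2l)`. -/
theorem unifNoise_real_ceil_ne_le (hl : 0 < l) (a b : ℝ) :
    (unifNoise l).real {s | ⌈(a - s) / (2 * l)⌉ ≠ ⌈(b - s) / (2 * l)⌉} ≤ |b - a| / (2 * l) := by
  wlog hab : a ≤ b generalizing a b
  · have := this b a (le_of_not_ge hab)
    simp only [ne_comm (a := ⌈(b - _) / (2 * l)⌉)] at this
    rwa [abs_sub_comm] at this
  have hl2 : 0 < 2 * l := by linarith
  rw [unifNoise_real_apply hl, abs_of_nonneg (sub_nonneg.2 hab)]
  gcongr
  -- If the grid separates `a` and `b`, then with `k` the ceiling for `a` the grid point `k * (2 *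
  -- l) + s` lies in `[a, b)`. For different `k` these translates fall into disjoint cells, so the
  -- total length is at most `b - a`.
  have hcover : Set.Ico 0 (2 * l) ∩ {s | ⌈(a - s) / (2 * l)⌉ ≠ ⌈(b - s) / (2 * l)⌉}
      ⊆ ⋃ k : ℤ, (fun s => k • (2 * l) + s) ⁻¹'
        (Set.Ico (k • (2 * l)) ((k + 1) • (2 * l)) ∩ Set.Ico a b) := by
    rintro s ⟨hs, hne⟩
    have hlt : ⌈(a - s) / (2 * l)⌉ < ⌈(b - s) / (2 * l)⌉ :=
      lt_of_le_of_ne (Int.ceil_mono (by gcongr)) hne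
    refine Set.mem_iUnion.2 ⟨⌈(a - s) / (2 * l)⌉, ⟨⟨?_, ?_⟩, ?_, ?_⟩⟩
    · simpa using hs.1
    · simpa [add_mul] using hs.2
    · have := (div_le_iff₀ hl2).1 (Int.le_ceil ((a - s) / (2 * l)))
      simp only [zsmul_eq_mul]
      linarith
    · have := (lt_div_iff₀ hl2).1 (Int.lt_ceil.1 hlt)
      simp only [zsmul_eq_mul]
      linarith
  have hle : volume (Set.Icc 0 (2 * l) ∩ {s | ⌈(a - s) / (2 * l)⌉ ≠ ⌈(b - s) / (2 * l)⌉})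
      ≤ ENNReal.ofReal (b - a) := by
    calc volume (Set.Icc 0 (2 * l) ∩ {s | ⌈(a - s) / (2 * l)⌉ ≠ ⌈(b - s) / (2 * l)⌉})
        = volume (Set.Ico 0 (2 * l) ∩ {s | ⌈(a - s) / (2 * l)⌉ ≠ ⌈(b - s) / (2 * l)⌉}) :=
          -- Dropping the endpoint `2 * l`, a null set, makes the cells half-open and hence
          -- disjoint.
          measure_congr (Ico_ae_eq_Icc.symm.inter (Filter.EventuallyEq.refl _ _))
      _ ≤ ∑' k : ℤ, volume ((fun s => k • (2 * l) + s) ⁻¹'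
            (Set.Ico (k • (2 * l)) ((k + 1) • (2 * l)) ∩ Set.Ico a b)) :=
          (measure_mono hcover).trans (measure_iUnion_le _)
      _ = ∑' k : ℤ, volume (Set.Ico (k • (2 * l)) ((k + 1) • (2 * l)) ∩ Set.Ico a b) := by
          simp only [measure_preimage_add]
      _ = volume (⋃ k : ℤ, Set.Ico (k • (2 * l)) ((k + 1) • (2 * l)) ∩ Set.Ico a b) := by
          refine (measure_iUnion (fun i j hij => ?_) fun k =>
            measurableSet_Ico.inter measurableSet_Ico).symm
          exact (Set.pairwise_disjoint_Ico_zsmul (2 * l) hij).mono Set.inter_subset_left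
            Set.inter_subset_left
      _ = ENNReal.ofReal (b - a) := by
          rw [← Set.iUnion_inter, iUnion_Ico_zsmul hl2, Set.univ_inter, Real.volume_Ico]
  exact ENNReal.toReal_le_of_le_ofReal (sub_nonneg.2 hab) hle

theorem measurable_ceil_sub_div (l a : ℝ) : Measurable fun s : ℝ => ⌈(a - s) / (2 * l)⌉ :=
  Int.measurable_ceil.comp (by fun_prop)

theorem measurable_splitPoint (l : ℝ) (x : Fin d → ℝ) : Measurable (splitPoint l x) := by
  refine measurable_pi_lambda _ fun i => ?_
  have h : ∀ f : (Fin d → ℝ) → ℝ, Measurable f → Measurable fun s => ((⌈f s⌉ : ℤ) : ℝ) :=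
    fun f hf => (measurable_from_top (f := fun k : ℤ => (k : ℝ))).comp (Int.measurable_ceil.comp hf)
  have h1 := h (fun s => (x i - s i) / (2 * l)) (by fun_prop)
  have h2 := h (fun s => (x i - s i) / (2 * l) - 1) (by fun_prop)
  unfold splitPoint
  fun_prop

/-- The smoothed expectation is `1 / (2l)`-Lipschitz for splitting noise. -/
theorem integral_splitScheme_le (hl : 0 < l) (ν : Measure (Fin d → ℝ)) [IsProbabilityMeasure ν]
    (hν : ∀ i, pdf.IsUniform (fun s : Fin d → ℝ => s i) (Set.Icc 0 (2 * l)) ν volume)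
    (x x' : Fin d → ℝ) {h : (Fin d → ℝ) → ℝ} (hm : Measurable h)
    (h01 : ∀ z, h z ∈ Set.Icc (0 : ℝ) 1) :
    ∫ z, h z ∂(splitScheme l ν x)
      ≤ ∫ z, h z ∂(splitScheme l ν x') + ‖WithLp.toLp 1 (x' - x)‖ / (2 * l) := by
  have hE : ∀ i, MeasurableSet {s : ℝ | ⌈(x i - s) / (2 * l)⌉ ≠ ⌈(x' i - s) / (2 * l)⌉} :=
    fun i => (measurableSet_eq_fun (measurable_ceil_sub_div l _)
      (measurable_ceil_sub_div l _)).compl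
  -- Off `D` no coordinate is separated and the two split points coincide. The union bound for `D`
  -- uses only the marginals of `ν`, so the joint law is irrelevant.
  set D : Set (Fin d → ℝ) := ⋃ i, (fun s : Fin d → ℝ => s i) ⁻¹'
    {s : ℝ | ⌈(x i - s) / (2 * l)⌉ ≠ ⌈(x' i - s) / (2 * l)⌉} with hD
  have hDm : MeasurableSet D := MeasurableSet.iUnion fun i => measurable_pi_apply i (hE i)
  have heq : ∀ s ∉ D, splitPoint l x s = splitPoint l x' s := fun s hs => by
    have hs' : ∀ i, ⌈(x i - s i) / (2 * l)⌉ = ⌈(x' i - s i) / (2 * l)⌉ := by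
      simpa [hD] using hs
    funext i
    simp only [splitPoint, Int.ceil_sub_one, hs']
  refine (integral_map_le_integral_map_add ν (measurable_splitPoint l x)
    (measurable_splitPoint l x') hDm heq hm h01).trans ?_
  refine add_le_add le_rfl ?_
  calc ν.real D ≤ ∑ i, ν.real ((fun s : Fin d → ℝ => s i) ⁻¹'
          {s : ℝ | ⌈(x i - s) / (2 * l)⌉ ≠ ⌈(x' i - s) / (2 * l)⌉}) :=
        measureReal_iUnion_fintype_le _
    _ ≤ ∑ i, |x' i - x i| / (2 * l) := Finset.sum_le_sum fun i _ => by
        rw [← map_measureReal_apply (measurable_pi_apply i) (hE i), hν i]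
        exact unifNoise_real_ceil_ne_le hl _ _
    _ = ‖WithLp.toLp 1 (x' - x)‖ / (2 * l) := by
        rw [PiLp.norm_eq_of_L1, Finset.sum_div]; rfl

theorem certValues_splitScheme_subset (hl : 0 < l) {r : ℝ} (ν : Measure (Fin d → ℝ))
    [IsProbabilityMeasure ν]
    (hν : ∀ i, pdf.IsUniform (fun s : Fin d → ℝ => s i) (Set.Icc 0 (2 * l)) ν volume)
    (x : Fin d → ℝ) (p : ℝ) :
    certValues (splitScheme l ν) (lpBall 1 r) x p ⊆
      Set.Icc (lipLower l r p) (lipUpper l r p) := by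
  rintro v ⟨x', hx', h, hm, h01, rfl, rfl⟩
  have hle : ‖WithLp.toLp 1 (x' - x)‖ / (2 * l) ≤ r / (2 * l) := by
    have : ‖WithLp.toLp 1 (x' - x)‖ ≤ r := hx'
    gcongr
  have h1 := integral_splitScheme_le hl ν hν x x' hm h01
  have h2 := integral_splitScheme_le hl ν hν x' x hm h01
  rw [← neg_sub, WithLp.toLp_neg, norm_neg] at h2
  constructor
  · rw [lipLower]; linarith
  · rw [lipUpper]; linarith

end Split

/-! ### Independent bit flips and simulation of tests. -/

section BitsLaw

variable {ι κ : Type*} [Fintype ι] [Fintype κ]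

/-- The law of the noisy version of the bit `b`. -/
def bitLaw (p0 p1 : unitInterval) (b : Bool) : Measure Bool :=
  (bernoulliMeasure true false (if b then p1 else p0)).map (xor b)

/-- The law of the noisy version of a family of bits, flipped independently. -/
def bitsLaw (p0 p1 : unitInterval) (x : ι → Bool) : Measure (ι → Bool) :=
  Measure.pi fun i => bitLaw p0 p1 (x i)

variable {p0 p1 : unitInterval}

instance (b : Bool) : IsProbabilityMeasure (bitLaw p0 p1 b) :=
  Measure.isProbabilityMeasure_map (Measurable.of_discrete).aemeasurable

instance (x : ι → Bool) : IsProbabilityMeasure (bitsLaw p0 p1 x) := by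
  unfold bitsLaw; infer_instance

theorem sparseScheme_eq_bitsLaw {d : ℕ} (x : Fin d → Bool) :
    sparseScheme p0 p1 x = bitsLaw p0 p1 x :=
  Measure.pi_map_pi (f := fun i => xor (x i))
    (hμ := fun i => inferInstanceAs (SigmaFinite (bitLaw p0 p1 (x i))))
    fun _ => (Measurable.of_discrete).aemeasurable

instance {d : ℕ} (x : Fin d → Bool) : IsProbabilityMeasure (sparseScheme p0 p1 x) := by
  rw [sparseScheme_eq_bitsLaw]; infer_instance

theorem bitsLaw_map_precomp {ψ : κ → ι} (hψ : ψ.Injective) (x : ι → Bool) :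
    (bitsLaw p0 p1 x).map (fun z => z ∘ ψ) = bitsLaw p0 p1 (x ∘ ψ) := by
  have h := iIndepFun_pi (μ := fun i => bitLaw p0 p1 (x i)) (X := fun _ b => b)
    fun i => (Measurable.of_discrete).aemeasurable
  have h' := (iIndepFun_iff_map_fun_eq_pi_map
    fun i => (Measurable.of_discrete).aemeasurable).1 (h.precomp hψ)
  refine h'.trans ?_
  congr 1
  funext i
  exact (measurePreserving_eval (fun i => bitLaw p0 p1 (x i)) (ψ i)).map_eq

theorem testValues_map_subset {X Y : Type*} [MeasurableSpace X] [MeasurableSpace Y]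
    (μ ν : Measure X) {f : X → Y} (hf : Measurable f) (p : ℝ) :
    testValues (μ.map f) (ν.map f) p ⊆ testValues μ ν p := by
  rintro v ⟨h, hm, h01, h1, h2⟩
  rw [integral_map hf.aemeasurable hm.aestronglyMeasurable] at h1 h2
  exact ⟨h ∘ f, hm.comp hf, fun z => h01 _, h1, h2⟩

/-- A test may ignore all coordinates outside the range of `ψ`; injectivity keeps the selected bits
independent. -/
theorem testValues_bitsLaw_precomp_subset {ψ : κ → ι} (hψ : ψ.Injective) (x x' : ι → Bool)
    (p : ℝ) : testValues (bitsLaw p0 p1 (x ∘ ψ)) (bitsLaw p0 p1 (x' ∘ ψ)) p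
      ⊆ testValues (bitsLaw p0 p1 x) (bitsLaw p0 p1 x') p := by
  rw [← bitsLaw_map_precomp hψ, ← bitsLaw_map_precomp hψ]
  exact testValues_map_subset _ _ Measurable.of_discrete p

theorem integral_bitsLaw_sumElim (u : ι → Bool) (x : κ → Bool) (f : (ι ⊕ κ → Bool) → ℝ) :
    ∫ z, f z ∂(bitsLaw p0 p1 (Sum.elim u x))
      = ∫ y, ∫ w, f (Sum.elim y w) ∂(bitsLaw p0 p1 x) ∂(bitsLaw p0 p1 u) := by
  have h := measurePreserving_sumPiEquivProdPi_symm
    (fun i : ι ⊕ κ => bitLaw p0 p1 (Sum.elim u x i))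
  have h' := h.integral_comp' f
  refine h'.symm.trans ?_
  refine (integral_prod _ (Integrable.of_finite)).trans ?_
  refine integral_congr_ae (ae_of_all _ fun y => integral_congr_ae (ae_of_all _ fun w => ?_))
  refine congrArg f (funext fun i => ?_)
  cases i <;> rfl

/-- A test for `x` against `x'` gives a test for `u` against `u'` if every bit of `x` and `x'`
is a bit of `u` and `u'` or a common bit, which can be simulated. -/
theorem testValues_bitsLaw_subset_of_sumElim {ψ : κ → ι ⊕ κ} (hψ : ψ.Injective)
    {u u' : ι → Bool} {x x' : κ → Bool} (hx : Sum.elim u x ∘ ψ = x)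
    (hx' : Sum.elim u' x ∘ ψ = x') (p : ℝ) :
    testValues (bitsLaw p0 p1 x) (bitsLaw p0 p1 x') p
      ⊆ testValues (bitsLaw p0 p1 u) (bitsLaw p0 p1 u') p := by
  rintro v ⟨h, hm, h01, h1, h2⟩
  have key : ∀ w : ι → Bool, ∫ y, ∫ z, h (Sum.elim y z ∘ ψ) ∂(bitsLaw p0 p1 x)
      ∂(bitsLaw p0 p1 w) = ∫ z, h z ∂(bitsLaw p0 p1 (Sum.elim w x ∘ ψ)) := fun w => by
    rw [← bitsLaw_map_precomp hψ, integral_map (Measurable.of_discrete).aemeasurable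
      hm.aestronglyMeasurable, integral_bitsLaw_sumElim]
  refine ⟨fun y => ∫ z, h (Sum.elim y z ∘ ψ) ∂(bitsLaw p0 p1 x), Measurable.of_discrete,
    fun y => integral_mem_Icc _ Measurable.of_discrete fun z => h01 _, ?_, ?_⟩
  · rw [key, hx, h1]
  · rw [key, hx', h2]

theorem bitLaw_real_singleton (b c : Bool) : (bitLaw p0 p1 b).real {c}
    = if b = c then 1 - (if b then (p1 : ℝ) else p0) else if b then (p1 : ℝ) else p0 := by
  classical
  rw [bitLaw, map_measureReal_apply Measurable.of_discrete (MeasurableSet.singleton _),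
    bernoulliMeasure_real_apply _ MeasurableSet.of_discrete]
  cases b <;> cases c <;> simp

theorem bitLaw_real_singleton_pos (h0 : 0 < p0) (h0' : p0 < 1) (h1 : 0 < p1) (h1' : p1 < 1)
    (b c : Bool) : 0 < (bitLaw p0 p1 b).real {c} := by
  have a0 : (0 : ℝ) < p0 := h0
  have a1 : (0 : ℝ) < p1 := h1
  have b0 : (p0 : ℝ) < 1 := h0'
  have b1 : (p1 : ℝ) < 1 := h1'
  rw [bitLaw_real_singleton]
  split_ifs <;> linarith

theorem bitsLaw_real_singleton (x z : ι → Bool) :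
    (bitsLaw p0 p1 x).real {z} = ∏ i, (bitLaw p0 p1 (x i)).real {z i} := by
  rw [measureReal_def, bitsLaw, Measure.pi_singleton, ENNReal.toReal_prod]
  rfl

theorem bitsLaw_absolutelyContinuous (h0 : 0 < p0) (h0' : p0 < 1) (h1 : 0 < p1) (h1' : p1 < 1)
    (x : ι → Bool) (ν : Measure (ι → Bool)) : ν ≪ bitsLaw p0 p1 x := by
  intro s hs
  suffices s = ∅ by simp [this]
  refine Set.eq_empty_iff_forall_notMem.2 fun z hz => ?_
  have hpos : 0 < (bitsLaw p0 p1 x).real {z} := by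
    rw [bitsLaw_real_singleton]
    exact Finset.prod_pos fun i _ => bitLaw_real_singleton_pos h0 h0' h1 h1' _ _
  have : (bitsLaw p0 p1 x).real {z} = 0 := by
    rw [measureReal_def, measure_mono_null (Set.singleton_subset_iff.2 hz) hs]; rfl
  linarith

/-- The likelihood ratio of flipping all bits depends on the Hamming distance only. -/
theorem exists_bitsLaw_compl_real_singleton_eq (h0 : 0 < p0) (h0' : p0 < 1) (h1 : 0 < p1)
    (h1' : p1 < 1) (u : ι → Bool) : ∃ c : ℕ → ℝ, ∀ z,
      (bitsLaw p0 p1 fun i => !u i).real {z}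
        = c (hammingDist u z) * (bitsLaw p0 p1 u).real {z} := by
  have a0 : (0 : ℝ) < p0 := h0
  have a1 : (0 : ℝ) < p1 := h1
  have b0 : 0 < 1 - (p0 : ℝ) := sub_pos.2 h0'
  have b1 : 0 < 1 - (p1 : ℝ) := sub_pos.2 h1'
  -- The factor by which a flipped coordinate changes the likelihood ratio relative to an unflipped
  -- one. It is the same for zeros and ones, which is why only the number of flips matters.
  set K : ℝ := (1 - p0) * (1 - p1) / (p0 * p1) with hK
  have key : ∀ b c : Bool, (bitLaw p0 p1 (!b)).real {c}
      = (bitLaw p0 p1 (!b)).real {b} / (bitLaw p0 p1 b).real {b} *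
        (if b ≠ c then K else 1) * (bitLaw p0 p1 b).real {c} := fun b c => by
    simp only [bitLaw_real_singleton, hK]
    cases b <;> cases c <;> simp <;> field_simp
  refine ⟨fun n => (∏ i, (bitLaw p0 p1 (!u i)).real {u i} / (bitLaw p0 p1 (u i)).real {u i}) *
    K ^ n, fun z => ?_⟩
  rw [bitsLaw_real_singleton, bitsLaw_real_singleton, Finset.prod_congr rfl fun i _ =>
    key (u i) (z i), Finset.prod_mul_distrib, Finset.prod_mul_distrib, Finset.prod_ite,
    Finset.prod_const, Finset.prod_const_one, mul_one]
  rfl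

end BitsLaw

/-! ### The linear program as a testing problem. -/

section LinearProgram

/-- A test can be averaged over the fibres of `D` if the likelihood ratio is constant there. -/
theorem exists_fiberwise_average {Y Q : Type*} [Fintype Y] [DecidableEq Q] (D : Y → Q)
    {a b g : Y → ℝ} (ha : ∀ y, 0 ≤ a y) {c : Q → ℝ} (hb : ∀ y, b y = c (D y) * a y)
    (hg : ∀ y, g y ∈ Set.Icc (0 : ℝ) 1) :
    ∃ h : Q → ℝ, (∀ q, h q ∈ Set.Icc (0 : ℝ) 1) ∧
      (∀ q, ∑ y with D y = q, g y * a y = h q * ∑ y with D y = q, a y) ∧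
      (∀ q, ∑ y with D y = q, g y * b y = h q * ∑ y with D y = q, b y) := by
  have hle : ∀ q, ∑ y with D y = q, g y * a y ≤ ∑ y with D y = q, a y := fun q =>
    Finset.sum_le_sum fun y _ => mul_le_of_le_one_left (ha y) (hg y).2
  have hnn : ∀ q, 0 ≤ ∑ y with D y = q, g y * a y := fun q =>
    Finset.sum_nonneg fun y _ => mul_nonneg (hg y).1 (ha y)
  have h1 : ∀ q, ∑ y with D y = q, g y * a y
      = (∑ y with D y = q, g y * a y) / (∑ y with D y = q, a y) * ∑ y with D y = q, a y :=
    fun q => by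
      -- On a fibre of zero weight the numerator is squeezed to 0 as well, so the value of the
      -- quotient does not matter.
      rcases eq_or_ne (∑ y with D y = q, a y) 0 with h0 | h0
      · rw [h0, mul_zero]
        exact le_antisymm (h0 ▸ hle q) (hnn q)
      · rw [div_mul_cancel₀ _ h0]
  refine ⟨fun q => (∑ y with D y = q, g y * a y) / ∑ y with D y = q, a y, fun q =>
    ⟨div_nonneg (hnn q) (Finset.sum_nonneg fun y _ => ha y),
      div_le_one_of_le₀ (hle q) (Finset.sum_nonneg fun y _ => ha y)⟩, h1, fun q => ?_⟩
  have hb1 : ∑ y with D y = q, b y = c q * ∑ y with D y = q, a y := by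
    rw [Finset.mul_sum]
    refine Finset.sum_congr rfl fun y hy => ?_
    rw [hb, (Finset.mem_filter.1 hy).2]
  have hb2 : ∑ y with D y = q, g y * b y = c q * ∑ y with D y = q, g y * a y := by
    rw [Finset.mul_sum]
    refine Finset.sum_congr rfl fun y hy => ?_
    rw [hb, (Finset.mem_filter.1 hy).2]
    ring
  rw [hb1, hb2, h1 q]
  ring

variable {p0 p1 : unitInterval}

/-- The Hamming distance to `canonPoint`, as the index of a region. -/
def region (ra rd : ℕ) (z : Fin (ra + rd) → Bool) : Fin (ra + rd + 1) :=
  ⟨hammingDist (canonPoint ra rd) z, Nat.lt_succ_of_le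
    (hammingDist_le_card_fintype.trans_eq (Fintype.card_fin _))⟩

theorem real_hammingDist_eq_sum {ra rd : ℕ} (μ : Measure (Fin (ra + rd) → Bool))
    [IsFiniteMeasure μ] (q : Fin (ra + rd + 1)) :
    μ.real {z | hammingDist (canonPoint ra rd) z = (q : ℕ)}
      = ∑ z with region ra rd z = q, μ.real {z} := by
  rw [sum_measureReal_singleton]
  congr 1
  ext z
  simp [region, Fin.ext_iff]

theorem integral_eq_sum_region {ra rd : ℕ} (μ : Measure (Fin (ra + rd) → Bool))
    [IsFiniteMeasure μ] (g : (Fin (ra + rd) → Bool) → ℝ) :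
    ∫ z, g z ∂μ = ∑ q, ∑ z with region ra rd z = q, g z * μ.real {z} := by
  rw [integral_fintype (Integrable.of_finite), Finset.sum_fiberwise]
  simp only [smul_eq_mul, mul_comm]

/-- A vector of the program is a test constant on the regions. Conversely, averaging a test over
each region changes neither integral, since the likelihood ratio is constant there. -/
theorem lpValues_eq_testValues (h0 : 0 < p0) (h0' : p0 < 1) (h1 : 0 < p1) (h1' : p1 < 1)
    (ra rd : ℕ) (p : ℝ) : lpValues p0 p1 ra rd p
      = testValues (bitsLaw p0 p1 (canonPoint ra rd)) (bitsLaw p0 p1 (canonPoint' ra rd)) p := by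
  have hr : ∀ q, regionMass p0 p1 ra rd q
      = ∑ z with region ra rd z = q, (bitsLaw p0 p1 (canonPoint ra rd)).real {z} := fun q => by
    rw [regionMass, sparseScheme_eq_bitsLaw, real_hammingDist_eq_sum]
  have hr' : ∀ q, regionMass' p0 p1 ra rd q
      = ∑ z with region ra rd z = q, (bitsLaw p0 p1 (canonPoint' ra rd)).real {z} := fun q => by
    rw [regionMass', sparseScheme_eq_bitsLaw, real_hammingDist_eq_sum]
  ext v
  constructor
  · rintro ⟨h, h01, e1, e2⟩
    have key : ∀ (μ : Measure (Fin (ra + rd) → Bool)) [IsFiniteMeasure μ],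
        ∫ z, h (region ra rd z) ∂μ
          = ∑ q, h q * ∑ z with region ra rd z = q, μ.real {z} := fun μ _ => by
      rw [integral_eq_sum_region]
      refine Finset.sum_congr rfl fun q _ => ?_
      rw [Finset.mul_sum]
      refine Finset.sum_congr rfl fun z hz => ?_
      rw [(Finset.mem_filter.1 hz).2]
    refine ⟨fun z => h (region ra rd z), Measurable.of_discrete, fun z => h01 _, ?_, ?_⟩
    · rw [key, ← e1]
      simp only [hr]
    · rw [key, ← e2]
      simp only [hr']
  · rintro ⟨g, -, g01, e1, e2⟩
    obtain ⟨c, hc⟩ := exists_bitsLaw_compl_real_singleton_eq h0 h0' h1 h1' (canonPoint ra rd)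
    obtain ⟨h, h01, hh, hh'⟩ := exists_fiberwise_average (region ra rd)
      (a := fun z => (bitsLaw p0 p1 (canonPoint ra rd)).real {z})
      (b := fun z => (bitsLaw p0 p1 (canonPoint' ra rd)).real {z}) (c := fun q => c q)
      (fun z => measureReal_nonneg) hc g01
    refine ⟨h, h01, ?_, ?_⟩
    · rw [← e1, integral_eq_sum_region]
      exact Finset.sum_congr rfl fun q _ => by rw [hr, hh]
    · rw [← e2, integral_eq_sum_region]
      exact Finset.sum_congr rfl fun q _ => by rw [hr', hh']

theorem isCompact_lpValues (p0 p1 : unitInterval) (ra rd : ℕ) (p : ℝ) :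
    IsCompact (lpValues p0 p1 ra rd p) := by
  have hK : IsCompact ((Set.univ.pi fun _ : Fin (ra + rd + 1) => Set.Icc (0 : ℝ) 1) ∩
      {h | ∑ q, h q * regionMass p0 p1 ra rd q = p}) :=
    (isCompact_univ_pi fun _ => isCompact_Icc).inter_right
      (isClosed_eq (by fun_prop) continuous_const)
  have := hK.image (f := fun h => ∑ q, h q * regionMass' p0 p1 ra rd q) (by fun_prop)
  convert this using 1
  ext v
  simp only [lpValues, Set.mem_image, Set.mem_inter_iff, Set.mem_univ_pi, Set.mem_ofPred_eq,
    and_assoc]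

end LinearProgram

/-! ### Sparse smoothing: reduction to the canonical pair and duality. -/

section Sparse

variable {p0 p1 : unitInterval} {d : ℕ}

/-- Toggled bits embed into canonical bits of the same kind, by the two budgets, and every other bit
is common to `x` and `x'` and can be simulated. Unspent budget leaves canonical bits that the test
ignores. -/
theorem testValues_subset_of_mem_sparseBall {ra rd : ℕ} {x x' : Fin d → Bool}
    (hx' : x' ∈ sparseBall ra rd x) (p : ℝ) :
    testValues (bitsLaw p0 p1 x) (bitsLaw p0 p1 x') p
      ⊆ testValues (bitsLaw p0 p1 (canonPoint ra rd)) (bitsLaw p0 p1 (canonPoint' ra rd)) p := by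
  obtain ⟨f⟩ : Nonempty ({i // x i = false ∧ x' i = true} ↪ Fin ra) :=
    Function.Embedding.nonempty_of_card_le (by
      rw [Fintype.card_subtype, Fintype.card_fin]; exact hx'.2)
  obtain ⟨g⟩ : Nonempty ({i // x i = true ∧ x' i = false} ↪ Fin rd) :=
    Function.Embedding.nonempty_of_card_le (by
      rw [Fintype.card_subtype, Fintype.card_fin]; exact hx'.1)
  let ψ : Fin d → Fin (ra + rd) ⊕ Fin d := fun i =>
    if h : x i = false ∧ x' i = true then Sum.inl (Fin.castAdd rd (f ⟨i, h⟩))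
    else if h : x i = true ∧ x' i = false then Sum.inl (Fin.natAdd ra (g ⟨i, h⟩))
    else Sum.inr i
  have hψ : ψ.Injective := by
    intro i j hij
    simp only [ψ] at hij
    split_ifs at hij with hi hj hj' hi' hj hj' hj hj'
    · simpa using hij
    · have := congrArg Fin.val (Sum.inl_injective hij)
      simp only [Fin.val_castAdd, Fin.val_natAdd] at this
      omega
    · have := congrArg Fin.val (Sum.inl_injective hij)
      simp only [Fin.val_castAdd, Fin.val_natAdd] at this
      omega
    · simpa using hij
    · simpa using hij
  refine testValues_bitsLaw_subset_of_sumElim hψ (funext fun i => ?_) (funext fun i => ?_) p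
  · simp only [ψ, Function.comp_apply]
    split_ifs with hi hi'
    · simp [canonPoint, hi.1]
    · simp [canonPoint, hi'.1]
    · rfl
  · simp only [ψ, Function.comp_apply]
    split_ifs with hi hi'
    · simp [canonPoint', canonPoint, hi.2]
    · simp [canonPoint', canonPoint, hi'.2]
    · simp only [Sum.elim_inr]
      cases h1 : x i <;> cases h2 : x' i <;> simp_all

theorem HasBits.exists_precomp_eq_canonPoint {ra rd : ℕ} {x : Fin d → Bool}
    (hx : HasBits ra rd x) :
    ∃ ψ : Fin (ra + rd) → Fin d, ψ.Injective ∧ x ∘ ψ = canonPoint ra rd := by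
  obtain ⟨f⟩ : Nonempty (Fin ra ↪ {i // x i = false}) :=
    Function.Embedding.nonempty_of_card_le (by
      rw [Fintype.card_subtype, Fintype.card_fin]; exact hx.1)
  obtain ⟨g⟩ : Nonempty (Fin rd ↪ {i // x i = true}) :=
    Function.Embedding.nonempty_of_card_le (by
      rw [Fintype.card_subtype, Fintype.card_fin]; exact hx.2)
  refine ⟨Fin.append (fun j => f j) (fun j => g j), fun i j => ?_, funext fun i => ?_⟩
  · refine Fin.addCases (fun i => ?_) (fun i => ?_) i <;>
      refine Fin.addCases (fun j => ?_) (fun j => ?_) j <;>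
      simp only [Fin.append_left, Fin.append_right] <;> intro hij
    · rw [f.injective (Subtype.ext hij)]
    · have := (f i).2
      rw [hij, (g j).2] at this
      cases this
    · have := (g i).2
      rw [hij, (f j).2] at this
      cases this
    · rw [g.injective (Subtype.ext hij)]
  · refine Fin.addCases (fun i => ?_) (fun i => ?_) i
    · simp [canonPoint, (f i).2]
    · simp [canonPoint, (g i).2]

/-- Toggling exactly the bits selected by `ψ` spends the whole budget and makes the canonical pair
appear inside `x` and `x'`. -/
theorem HasBits.exists_mem_sparseBall {ra rd : ℕ} {x : Fin d → Bool} (hx : HasBits ra rd x) :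
    ∃ x' ∈ sparseBall ra rd x, ∃ ψ : Fin (ra + rd) → Fin d, ψ.Injective ∧
      x ∘ ψ = canonPoint ra rd ∧ x' ∘ ψ = canonPoint' ra rd := by
  classical
  obtain ⟨ψ, hψ, hxψ⟩ := hx.exists_precomp_eq_canonPoint
  refine ⟨fun i => if i ∈ Set.range ψ then !x i else x i, ⟨?_, ?_⟩, ψ, hψ, hxψ, ?_⟩
  · refine (Finset.card_le_card (t := Finset.univ.image fun j => ψ (Fin.natAdd ra j))
      fun i hi => ?_).trans (Finset.card_image_le.trans_eq (Finset.card_fin rd))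
    obtain ⟨h1, h2⟩ := (Finset.mem_filter.1 hi).2
    have hr : i ∈ Set.range ψ := by simpa [h1] using h2
    obtain ⟨j, rfl⟩ := hr
    have hj : canonPoint ra rd j = true := by rw [← hxψ]; exact h1
    revert hj
    refine Fin.addCases (fun j hj => ?_) (fun j _ => ?_) j
    · simp [canonPoint] at hj
    · exact Finset.mem_image_of_mem _ (Finset.mem_univ _)
  · refine (Finset.card_le_card (t := Finset.univ.image fun j => ψ (Fin.castAdd rd j))
      fun i hi => ?_).trans (Finset.card_image_le.trans_eq (Finset.card_fin ra))
    obtain ⟨h1, h2⟩ := (Finset.mem_filter.1 hi).2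
    have hr : i ∈ Set.range ψ := by simpa [h1] using h2
    obtain ⟨j, rfl⟩ := hr
    have hj : canonPoint ra rd j = false := by rw [← hxψ]; exact h1
    revert hj
    refine Fin.addCases (fun j _ => ?_) (fun j hj => ?_) j
    · exact Finset.mem_image_of_mem _ (Finset.mem_univ _)
    · simp [canonPoint] at hj
  · funext j
    simp [canonPoint', ← hxψ]

theorem certValues_sparse_subset_lpValues (h0 : 0 < p0) (h0' : p0 < 1) (h1 : 0 < p1)
    (h1' : p1 < 1) (ra rd : ℕ) (x : Fin d → Bool) (p : ℝ) :
    certValues (sparseScheme p0 p1) (sparseBall ra rd) x p ⊆ lpValues p0 p1 ra rd p := by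
  rintro v ⟨x', hx', hv⟩
  rw [lpValues_eq_testValues h0 h0' h1 h1']
  rw [sparseScheme_eq_bitsLaw, sparseScheme_eq_bitsLaw] at hv
  exact testValues_subset_of_mem_sparseBall hx' p hv

theorem certValues_sparse_eq_lpValues (h0 : 0 < p0) (h0' : p0 < 1) (h1 : 0 < p1) (h1' : p1 < 1)
    {ra rd : ℕ} {x : Fin d → Bool} (hx : HasBits ra rd x) (p : ℝ) :
    certValues (sparseScheme p0 p1) (sparseBall ra rd) x p = lpValues p0 p1 ra rd p := by
  refine (certValues_sparse_subset_lpValues h0 h0' h1 h1' ra rd x p).antisymm fun v hv => ?_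
  obtain ⟨x', hx', ψ, hψ, e, e'⟩ := hx.exists_mem_sparseBall
  rw [lpValues_eq_testValues h0 h0' h1 h1', ← e, ← e'] at hv
  refine mem_certValues.2 ⟨x', hx', ?_⟩
  rw [sparseScheme_eq_bitsLaw, sparseScheme_eq_bitsLaw]
  exact testValues_bitsLaw_precomp_subset hψ x x' p hv

theorem nonempty_lpValues (h0 : 0 < p0) (h0' : p0 < 1) (h1 : 0 < p1) (h1' : p1 < 1) (ra rd : ℕ)
    {p : ℝ} (hp : p ∈ Set.Icc (0 : ℝ) 1) : (lpValues p0 p1 ra rd p).Nonempty := by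
  rw [lpValues_eq_testValues h0 h0' h1 h1']
  exact ⟨p, self_mem_testValues _ _ hp⟩

theorem isLeast_sparseLower (h0 : 0 < p0) (h0' : p0 < 1) (h1 : 0 < p1) (h1' : p1 < 1)
    (ra rd : ℕ) {p : ℝ} (hp : p ∈ Set.Icc (0 : ℝ) 1) :
    IsLeast (lpValues p0 p1 ra rd p) (sparseLower p0 p1 ra rd p) :=
  (isCompact_lpValues p0 p1 ra rd p).isLeast_sInf (nonempty_lpValues h0 h0' h1 h1' ra rd hp)

theorem isGreatest_sparseUpper (h0 : 0 < p0) (h0' : p0 < 1) (h1 : 0 < p1) (h1' : p1 < 1)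
    (ra rd : ℕ) {p : ℝ} (hp : p ∈ Set.Icc (0 : ℝ) 1) :
    IsGreatest (lpValues p0 p1 ra rd p) (sparseUpper p0 p1 ra rd p) :=
  (isCompact_lpValues p0 p1 ra rd p).isGreatest_sSup (nonempty_lpValues h0 h0' h1 h1' ra rd hp)

theorem canonPoint'_comp_finAddFlip (ra rd : ℕ) :
    canonPoint' ra rd ∘ finAddFlip = canonPoint rd ra := by
  funext i
  refine Fin.addCases (fun i => ?_) (fun i => ?_) i <;> simp [canonPoint', canonPoint]

/-- Up to reordering the coordinates, complementing the canonical point exchanges `ra` and `rd`. The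
program with exchanged budgets is thus the same testing problem with its two laws exchanged. -/
theorem lpValues_swap_eq_testValues (h0 : 0 < p0) (h0' : p0 < 1) (h1 : 0 < p1) (h1' : p1 < 1)
    (ra rd : ℕ) (p : ℝ) : lpValues p0 p1 rd ra p
      = testValues (bitsLaw p0 p1 (canonPoint' ra rd)) (bitsLaw p0 p1 (canonPoint ra rd)) p := by
  have e := canonPoint'_comp_finAddFlip ra rd
  have e' : canonPoint ra rd ∘ finAddFlip = canonPoint' rd ra := by
    funext i
    simp [canonPoint', ← e]
  rw [lpValues_eq_testValues h0 h0' h1 h1', ← e, ← e']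
  refine (testValues_bitsLaw_precomp_subset finAddFlip.injective _ _ p).antisymm ?_
  have := testValues_bitsLaw_precomp_subset (p0 := p0) (p1 := p1)
    (finAddFlip (m := rd) (n := ra)).symm.injective (canonPoint' ra rd ∘ finAddFlip)
    (canonPoint ra rd ∘ finAddFlip) p
  simpa only [Function.comp_assoc, Equiv.self_comp_symm, Function.comp_id] using this

/-- Duality of level and power for the canonical pair; flip probabilities strictly between 0 and 1
give every point positive mass, hence absolute continuity. -/
theorem sparseLower_sparseUpper (h0 : 0 < p0) (h0' : p0 < 1) (h1 : 0 < p1) (h1' : p1 < 1)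
    (ra rd : ℕ) {p : ℝ} (hp : p ∈ Set.Icc (0 : ℝ) 1) :
    sparseLower p0 p1 ra rd (sparseUpper p0 p1 rd ra p) = p := by
  have h := isGreatest_sparseUpper h0 h0' h1 h1' rd ra hp
  rw [lpValues_swap_eq_testValues h0 h0' h1 h1'] at h
  have h' := isLeast_testValues_of_isGreatest
    (bitsLaw_absolutelyContinuous h0 h0' h1 h1' _ _) h
  rw [← lpValues_eq_testValues h0 h0' h1 h1'] at h'
  exact h'.csInf_eq

end Sparse

end Smoothing

end

/-! ### Assembly of the results for all schemes. -/

theorem mainTheorem4 :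
    -- the inverted balls
    (∀ (d : ℕ) (r : ℝ),
      Smoothing.invBall (Smoothing.lpBall (d := d) 1 r) = Smoothing.lpBall 1 r ∧
      Smoothing.invBall (Smoothing.lpBall (d := d) 2 r) = Smoothing.lpBall 2 r) ∧
    (∀ d ra rd : ℕ,
      Smoothing.invBall (Smoothing.sparseBall (d := d) ra rd) = Smoothing.sparseBall rd ra) ∧
    -- Gaussian smoothing under the `ℓ₁` and the `ℓ₂` ball
    (∀ (d : ℕ) (σ : ℝ≥0) (r : ℝ) (q : ℝ≥0∞), 0 < σ → 0 ≤ r → q = 1 ∨ q = 2 →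
      (0 < d → ∀ (x : Fin d → ℝ) (p : ℝ), p ∈ Set.Ioo (0 : ℝ) 1 →
        IsLeast (Smoothing.certValues (Smoothing.gaussianScheme σ) (Smoothing.lpBall q r) x p)
          (Smoothing.gaussCDF σ (Smoothing.gaussQuantile σ p - r)) ∧
        IsGreatest (Smoothing.certValues (Smoothing.gaussianScheme σ) (Smoothing.lpBall q r) x p)
          (Smoothing.gaussCDF σ (Smoothing.gaussQuantile σ p + r))) ∧
      (∀ (x y : Fin d → ℝ) (p : ℝ), p ∈ Set.Icc (0 : ℝ) 1 →
        Smoothing.certLower (Smoothing.gaussianScheme σ) (Smoothing.lpBall q r) x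
          (Smoothing.certUpper (Smoothing.gaussianScheme σ)
            (Smoothing.invBall (Smoothing.lpBall q r)) y p) = p)) ∧
    -- uniform smoothing
    (∀ (d : ℕ) (l r : ℝ), 0 < l → 0 ≤ r →
      -- the Lipschitz bounds, for every `p`
      (∀ p : ℝ, Smoothing.lipLower l r (Smoothing.lipUpper l r p) = p) ∧
      -- up to clipping to `[0, 1]` they are the optimal bounds for additive noise
      (0 < d → ∀ (x : Fin d → ℝ) (p : ℝ), p ∈ Set.Icc (0 : ℝ) 1 →
        IsLeast (Smoothing.certValues (Smoothing.uniformScheme l) (Smoothing.lpBall 1 r) x p)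
          (max 0 (Smoothing.lipLower l r p)) ∧
        IsGreatest (Smoothing.certValues (Smoothing.uniformScheme l) (Smoothing.lpBall 1 r) x p)
          (min 1 (Smoothing.lipUpper l r p))) ∧
      -- the optimal bounds, as long as the upper bound is not clipped
      (∀ (x y : Fin d → ℝ) (p : ℝ), p ∈ Set.Icc (0 : ℝ) 1 → Smoothing.lipUpper l r p ≤ 1 →
        Smoothing.certLower (Smoothing.uniformScheme l) (Smoothing.lpBall 1 r) x
          (Smoothing.certUpper (Smoothing.uniformScheme l)
            (Smoothing.invBall (Smoothing.lpBall 1 r)) y p) = p) ∧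
      (∀ (x y : Fin d → ℝ) (p : ℝ), p ∈ Set.Icc (0 : ℝ) 1 →
        Smoothing.certUpper (Smoothing.uniformScheme l)
          (Smoothing.invBall (Smoothing.lpBall 2 r)) y p < 1 →
        Smoothing.certLower (Smoothing.uniformScheme l) (Smoothing.lpBall 2 r) x
          (Smoothing.certUpper (Smoothing.uniformScheme l)
            (Smoothing.invBall (Smoothing.lpBall 2 r)) y p) = p) ∧
      -- the Lipschitz bounds are certified bounds for splitting noise
      (∀ ν : MeasureTheory.Measure (Fin d → ℝ), MeasureTheory.IsProbabilityMeasure ν →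
        (∀ i, MeasureTheory.pdf.IsUniform (fun s : Fin d → ℝ => s i) (Set.Icc 0 (2 * l)) ν
          MeasureTheory.volume) →
        ∀ (x : Fin d → ℝ) (p : ℝ),
        ∀ v ∈ Smoothing.certValues (Smoothing.splitScheme l ν) (Smoothing.lpBall 1 r) x p,
          Smoothing.lipLower l r p ≤ v ∧ v ≤ Smoothing.lipUpper l r p)) ∧
    -- sparse smoothing
    (∀ (p0 p1 : unitInterval) (ra rd : ℕ), 0 < p0 → p0 < 1 → 0 < p1 → p1 < 1 →
      (∀ p : ℝ, p ∈ Set.Icc (0 : ℝ) 1 →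
        Smoothing.sparseLower p0 p1 ra rd (Smoothing.sparseUpper p0 p1 rd ra p) = p) ∧
      -- at every point the linear programs give valid bounds
      (∀ (d : ℕ) (x : Fin d → Bool) (p : ℝ),
        ∀ v ∈ Smoothing.certValues (Smoothing.sparseScheme p0 p1) (Smoothing.sparseBall ra rd) x p,
          Smoothing.sparseLower p0 p1 ra rd p ≤ v ∧ v ≤ Smoothing.sparseUpper p0 p1 ra rd p) ∧
      -- they are optimal at every point where the whole budget can be spent
      (∀ (d : ℕ) (x : Fin d → Bool) (p : ℝ), Smoothing.HasBits ra rd x →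
        p ∈ Set.Icc (0 : ℝ) 1 →
        IsLeast (Smoothing.certValues (Smoothing.sparseScheme p0 p1)
          (Smoothing.sparseBall ra rd) x p) (Smoothing.sparseLower p0 p1 ra rd p) ∧
        IsGreatest (Smoothing.certValues (Smoothing.sparseScheme p0 p1)
          (Smoothing.sparseBall ra rd) x p) (Smoothing.sparseUpper p0 p1 ra rd p)) ∧
      (∀ (d : ℕ) (x y : Fin d → Bool) (p : ℝ), Smoothing.HasBits ra rd x →
        Smoothing.HasBits rd ra y → p ∈ Set.Icc (0 : ℝ) 1 →
        Smoothing.certLower (Smoothing.sparseScheme p0 p1) (Smoothing.sparseBall ra rd) x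
          (Smoothing.certUpper (Smoothing.sparseScheme p0 p1)
            (Smoothing.invBall (Smoothing.sparseBall ra rd)) y p) = p)) := by
  refine ⟨fun d r => ⟨Smoothing.invBall_lpBall 1 r, Smoothing.invBall_lpBall 2 r⟩,
    fun d ra rd => Smoothing.invBall_sparseBall ra rd, ?_, ?_, ?_⟩
  · intro d σ r q hσ hr hq
    refine ⟨fun hd x p hp => ?_,
      fun x y p hp => Smoothing.certLower_certUpper_gaussian hσ hq hr x y hp⟩
    obtain ⟨t, rfl⟩ := Smoothing.exists_gaussCDF_eq hσ hp
    rw [Smoothing.gaussQuantile_gaussCDF hσ]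
    exact ⟨Smoothing.isLeast_certValues_gaussian hσ hd hq hr x t,
      Smoothing.isGreatest_certValues_gaussian hσ hd hq hr x t⟩
  · intro d l r hl hr
    rw [Smoothing.invBall_lpBall, Smoothing.invBall_lpBall]
    exact ⟨Smoothing.lipLower_lipUpper l r,
      fun hd x p hp => ⟨Smoothing.isLeast_certValues_uniform hl hr hd x hp,
        Smoothing.isGreatest_certValues_uniform hl hr hd x hp⟩,
      fun x y p hp h1 => Smoothing.certLower_certUpper_uniform_one hl hr x y hp h1,
      fun x y p hp h1 => Smoothing.certLower_certUpper_uniform hl hr x y hp h1,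
      fun ν _ hν x p v hv => Smoothing.certValues_splitScheme_subset hl ν hν x p hv⟩
  · intro p0 p1 ra rd h0 h0' h1 h1'
    refine ⟨fun p hp => Smoothing.sparseLower_sparseUpper h0 h0' h1 h1' ra rd hp,
      fun d x p v hv => ?_, fun d x p hx hp => ?_, fun d x y p hx hy hp => ?_⟩
    · have hv' := Smoothing.certValues_sparse_subset_lpValues h0 h0' h1 h1' ra rd x p hv
      have hc := Smoothing.isCompact_lpValues p0 p1 ra rd p
      exact ⟨csInf_le hc.bddBelow hv', le_csSup hc.bddAbove hv'⟩
    · rw [Smoothing.certValues_sparse_eq_lpValues h0 h0' h1 h1' hx]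
      exact ⟨Smoothing.isLeast_sparseLower h0 h0' h1 h1' ra rd hp,
        Smoothing.isGreatest_sparseUpper h0 h0' h1 h1' ra rd hp⟩
    · rw [Smoothing.invBall_sparseBall, Smoothing.certUpper,
        Smoothing.certValues_sparse_eq_lpValues h0 h0' h1 h1' hy, Smoothing.certLower,
        Smoothing.certValues_sparse_eq_lpValues h0 h0' h1 h1' hx]
      exact Smoothing.sparseLower_sparseUpper h0 h0' h1 h1' ra rd hp
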